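/- **Setting.** Let $(\mathcal X,P_X)$ be a probability space of inputs, let $\mathcal W\subseteq\mathbb R^{d_w}$ ($d_w\ge 1$) be a measurable parameter set, and let $W$ be a $\mathcal W$-valued random parameter, independent of $X\sim P_X$, whose prior $P_W$ is absolutely continuous with respect to Lebesgue measure, with differential entropy $h(W)=-\int f\log f\in[-\infty,\infty]$ in nats, $f$ being the density of $P_W$. Let $p(y\mid x,w)$, $y\in\{0,1\}$, be a *realizable* binary model, i.e. $p(y\mid x,w)\in\{0,1\}$ for all $y,x,w$, and suppose that the class of classification rules $x\mapsto\arg\max_y p(y\mid x,w)$, $w\in\mathcal W$, has finite VC dimension $d_{\mathrm{vc}}$. The labels $Y$ are corrupted by noise that does not depend on the parameter: given $X=x$ and $Y=y$, the noisy label $\widetilde Y$ is drawn from a distribution $\nu(\cdot\mid x,y)$ on $\{0,1\}$, independently of $W$, so that the noisy model is $\widetilde p(\widetilde y\mid x,w)=\sum_y \nu(\widetilde y\mid x,y)\,p(y\mid x,w)$. Assume: 1. (*Tsybakov–Mammen condition with margin $t>0$*) $|2\widetilde p(y\mid x,w)-1|\ge t$ for all $x\in\mathcal X$, $w\in\mathcal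 W$, $y\in\{0,1\}$. 2. (*$\mu$-sensitivity in expectation, $0<\mu<\infty$*) For every conditional distribution $P_{V\mid W}$ on $\mathcal W$ that is absolutely continuous with respect to Lebesgue measure, $$\mathbb E_{W,V}\big[\mathbb P_X[X\in\mathcal E(W,V)]\big]\;\ge\;\mu\,\mathbb E_{W,V}\big[\|W-V\|_\infty\big],$$ where $\mathcal E(w,v)=\{x:\arg\max_y\widetilde p(y\mid x,w)\ne\arg\max_y\widetilde p(y\mid x,v)\}$. A (randomized) parametric learning rule $Q_{\widehat W\mid\widetilde Z^n}$ outputs an estimate $\widehat W\in\mathcal W$ from $n$ noisy samples $\widetilde Z_i=(X_i,\widetilde Y_i)$, drawn i.i.d. given $W$ from the noisy model. Its excess Bayes risk under the 0-1 loss is $$E_n(Q)=\mathbb P\big[\arg\max_y\widetilde p(y\mid X,\widehat W)\ne\widetilde Y\big]-\mathbb P\big[\arg\max_y\widetilde p(y\mid X,W)\ne\widetilde Y\big],$$ where the test sample $(X,\widetilde Y)$ is drawn from the noisy model given $W$, independently of the training samples and $\widehat W$ given $W$. **Theorem.** For every $n\ge d_{\mathrm{vc}}$ and every learning rule $Q_{\widehat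 W\mid \widetilde Z^n}$, $$E_n(Q)\;\ge\;\frac{\mu t}{2e}\left(\frac{d_{\mathrm{vc}}}{e\,n}\right)^{d_{\mathrm{vc}}/d_w}\exp\!\left(\frac{h(W)}{d_w}\right).$$ -/

import Mathlib

open MeasureTheory ProbabilityTheory

noncomputable section

namespace LabelNoise

/-!
Labels are `Bool`, inputs range over a measurable space `𝒳`, and parameters range over a set
`𝒲 ⊆ ℝ^d`.  The space `Fin d → ℝ` carries the sup norm and Lebesgue measure.
A model is given by an input law `PX` (not depending on the parameter), a prior `PW` on `𝒲`
and a label kernel `p`, where `p (x, w) {y}` is the probability `p(y | x, w)`.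
-/

variable {𝒳 : Type*} [MeasurableSpace 𝒳] {d : ℕ} {𝒲 : Set (Fin d → ℝ)}

/-- `argmax_y q(y)`, as the set of all maximizers. -/
def argmaxLabels (q : Measure Bool) : Set Bool := {y | ∀ y', q {y'} ≤ q {y}}

/-- The model family is realizable: `p(y | x, w) ∈ {0, 1}` for all `y, x, w`. -/
def IsRealizable (p : Kernel (𝒳 × 𝒲) Bool) : Prop :=
  ∀ (x : 𝒳) (w : 𝒲) (y : Bool), p (x, w) {y} = 0 ∨ p (x, w) {y} = 1

/-- The inputs that are classified as `true` under the parameter `w`. -/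
def positiveRegion (p : Kernel (𝒳 × 𝒲) Bool) (w : 𝒲) : Set 𝒳 :=
  {x | argmaxLabels (p (x, w)) = {true}}

/-- The finite set `s` of inputs is shattered: every labeling of `s` is produced by some `w`. -/
def IsShattered (p : Kernel (𝒳 × 𝒲) Bool) (s : Finset 𝒳) : Prop :=
  ∀ t : Set 𝒳, t ⊆ s → ∃ w : 𝒲, (s : Set 𝒳) ∩ positiveRegion p w = t

/-- VC dimension of the classification rules induced by `p`: the largest size of a shattered
finite set (`⊤` if there are shattered sets of arbitrarily large size). -/
def vcDimension (p : Kernel (𝒳 × 𝒲) Bool) : ℕ∞ :=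
  ⨆ (s : Finset 𝒳) (_ : IsShattered p s), (s.card : ℕ∞)

/-- The label kernel of the noisy model.  Given the input `x` and the clean label `y`, the noisy
label is drawn from `noise (x, y)`, independently of the parameter:
`p̃(ỹ | x, w) = ∑_y noise(ỹ | x, y) p(y | x, w)`. -/
def noisyLabels (p : Kernel (𝒳 × 𝒲) Bool) (noise : Kernel (𝒳 × Bool) Bool) :
    Kernel (𝒳 × 𝒲) Bool :=
  (p ⊗ₖ noise.comap (fun a : (𝒳 × 𝒲) × Bool => (a.1.1, a.2)) (by fun_prop)).snd

/-- Tsybakov-Mammen condition with margin `t`. -/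
def TsybakovMammen (p : Kernel (𝒳 × 𝒲) Bool) (t : ℝ) : Prop :=
  ∀ (x : 𝒳) (w : 𝒲) (y : Bool), t ≤ |2 * (p (x, w)).real {y} - 1|

/-- The discrepancy set of two parameters: the inputs that they classify differently. -/
def discrepancySet (p : Kernel (𝒳 × 𝒲) Bool) (w v : 𝒲) : Set 𝒳 :=
  {x | argmaxLabels (p (x, w)) ≠ argmaxLabels (p (x, v))}

/-- `mu`-sensitivity in expectation: `E[P_X(X ∈ 𝓔(W, V))] ≥ mu * E‖W - V‖_∞` for every conditional
law `P_{V|W}` on `𝒲` which is absolutely continuous with respect to Lebesgue measure. -/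
def SensitiveInExpectation (PX : Measure 𝒳) (PW : Measure 𝒲) (p : Kernel (𝒳 × 𝒲) Bool)
    (mu : ℝ) : Prop :=
  ∀ V : Kernel 𝒲 𝒲, IsMarkovKernel V →
    (∀ w, (V w).map (Subtype.val : 𝒲 → Fin d → ℝ) ≪ volume) →
    ENNReal.ofReal mu * ∫⁻ w, ∫⁻ v, ‖(w : Fin d → ℝ) - (v : Fin d → ℝ)‖ₑ ∂(V w) ∂PW
      ≤ ∫⁻ w, ∫⁻ v, PX (discrepancySet p w v) ∂(V w) ∂PW

/-- The law of a sample `Z = (X, Y)` given the parameter `w`. -/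
def sampleLaw (PX : Measure 𝒳) (p : Kernel (𝒳 × 𝒲) Bool) (w : 𝒲) : Measure (𝒳 × Bool) :=
  PX ⊗ₘ p.comap (fun x => (x, w)) (by fun_prop)

/-- The 0-1 loss `𝕀[argmax_{y'} p(y' | x, v) ≠ y]` of the plug-in classifier with parameter `v`
at the test sample `z = (x, y)`. -/
def zeroOneLoss (p : Kernel (𝒳 × 𝒲) Bool) (z : 𝒳 × Bool) (v : 𝒲) : ℝ :=
  Set.indicator {z : 𝒳 × Bool | argmaxLabels (p (z.1, v)) ≠ {z.2}} (fun _ => 1) z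

/-- The Bayes risk `L_n(Q)` of a (randomized) parametric learning rule `Q`: the parameter is drawn
from the prior, `n` training samples and a test sample are drawn i.i.d. given the parameter, and
the estimate is drawn from `Q` given the training samples. -/
def bayesRisk (PX : Measure 𝒳) (PW : Measure 𝒲) (p : Kernel (𝒳 × 𝒲) Bool) {n : ℕ}
    (Q : Kernel (Fin n → 𝒳 × Bool) 𝒲) : ℝ :=
  ∫ w, ∫ zs, ∫ v, ∫ z, zeroOneLoss p z v ∂(sampleLaw PX p w) ∂(Q zs)
    ∂(Measure.pi fun _ : Fin n => sampleLaw PX p w) ∂PW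

/-- The oracle Bayes risk `L^* = E[ℓ(Z; W)]`. -/
def oracleRisk (PX : Measure 𝒳) (PW : Measure 𝒲) (p : Kernel (𝒳 × 𝒲) Bool) : ℝ :=
  ∫ w, ∫ z, zeroOneLoss p z w ∂(sampleLaw PX p w) ∂PW

/-- The excess Bayes risk `E_n(Q) = L_n(Q) - L^*`. -/
def excessBayesRisk (PX : Measure 𝒳) (PW : Measure 𝒲) (p : Kernel (𝒳 × 𝒲) Bool) {n : ℕ}
    (Q : Kernel (Fin n → 𝒳 × Bool) 𝒲) : ℝ :=
  bayesRisk PX PW p Q - oracleRisk PX PW p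

/-- Differential entropy `-∫ f log f` (in nats) of a law on `ℝ^d` with Lebesgue density `f`, as an
extended real number: the integral of the positive part of `-f log f` minus that of its negative
part (`⊥` in the undefined case `∞ - ∞`). -/
def differentialEntropy (P : Measure (Fin d → ℝ)) : EReal :=
  ((∫⁻ x, ENNReal.ofReal (Real.negMulLog (P.rnDeriv volume x).toReal) : ENNReal) : EReal) -
    ((∫⁻ x, ENNReal.ofReal (-Real.negMulLog (P.rnDeriv volume x).toReal) : ENNReal) : EReal)

end LabelNoise

end

open scoped ENNReal

noncomputable section

namespace LabelNoise

/-! The argument is a Shannon lower bound. Let `ρ(w, v)` be the `PX`-mass of the discrepancy set,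
and `D` the expected `ρ` between the parameter and its estimate. The margin gives excess risk at
least `t * D` (`discrepancy_le_excessBayesRisk`), so it remains to bound `D` below in terms of the
entropy.

For every slope `s > 0`, the Gibbs inequality yields `h(W) ≤ log c + s * D` once `c` bounds the
integral of `exp (-s ρ(w, v))` against the law of the estimate given `w` and Lebesgue measure on the
support of the density (`entropy_le_log_add`). Two facts supply `c`.

Counting: in a realizable model with parameter-free noise, the estimate depends on `w` only through
the clean labels of the `n` inputs. By Sauer-Shelah there are at most `M = ∑_{k ≤ dvc} C(n, k)`
label patterns. For a fixed pattern the law of `v` is free of `w`, so the integral is at most `M`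
times the supremum over `v` of `∫ exp (-s ρ(w, v)) dw` (`lintegral_estimate_le`).

Volume: sensitivity in expectation, tested on cleverly chosen conditional laws, self-improves to
`ρ(w, w') ≥ mu ‖w - w'‖` for almost all pairs (`ae_le_of_forall_kernel`, `ae_sensitive`). By the
triangle inequality a `ρ`-ball of radius `r` then has essential diameter at most `2r/mu`, hence
volume at most `(2r/mu)^d` in the sup norm, and the layer-cake formula bounds the exponential
integral by `d! (2/(mu s))^d`.

Taking `s = d/D` and `d! ≤ d^d` gives `D ≥ mu/(2e) * M^(-1/d) * exp(h/d)` (`entropy_power_le`), and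
`M ≤ (e n/dvc)^dvc` finishes. -/

/-! ### Countable approximation of the sections of a measurable set -/

section Sections

variable {X Ω : Type*} [MeasurableSpace X] [MeasurableSpace Ω]

/-- The sections of a product-measurable set form a separable family in measure. -/
theorem exists_countable_approx_sections (P : Measure X) [IsFiniteMeasure P]
    {C : Set (X × Ω)} (hC : MeasurableSet C) :
    ∃ 𝒟 : Set (Set X), 𝒟.Countable ∧ (∀ D ∈ 𝒟, MeasurableSet D) ∧
      ∀ w : Ω, ∀ ε : ℝ≥0∞, ε ≠ 0 → ∃ D ∈ 𝒟, P (symmDiff {x | (x, w) ∈ C} D) < ε := by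
  have hC' : MeasurableSet[MeasurableSpace.generateFrom
      (Set.image2 (· ×ˢ ·) {s : Set X | MeasurableSet s} {t : Set Ω | MeasurableSet t})] C := by
    rw [generateFrom_prod]; exact hC
  -- The σ-algebra of `X` need not be countably generated, so separability cannot come from the
  -- space itself. It holds for rectangles, which have only two distinct sections, and survives
  -- complements and countable unions.
  refine MeasurableSpace.generateFrom_induction _
    (fun C _ => ∃ 𝒟 : Set (Set X), 𝒟.Countable ∧ (∀ D ∈ 𝒟, MeasurableSet D) ∧
      ∀ w : Ω, ∀ ε : ℝ≥0∞, ε ≠ 0 → ∃ D ∈ 𝒟, P (symmDiff {x | (x, w) ∈ C} D) < ε)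
    ?_ ?_ ?_ ?_ C hC'
  · rintro _ ⟨s, hs, t, ht, rfl⟩ _
    refine ⟨{s, ∅}, by simp, ?_, fun w ε hε => ?_⟩
    · rintro D (rfl | rfl)
      exacts [hs, MeasurableSet.empty]
    · by_cases hw : w ∈ t
      · exact ⟨s, by simp, by simpa [hw] using pos_iff_ne_zero.2 hε⟩
      · exact ⟨∅, by simp, by simpa [hw] using pos_iff_ne_zero.2 hε⟩
  · exact ⟨{∅}, by simp, by simp, fun w ε hε => ⟨∅, by simp, by
      simpa using pos_iff_ne_zero.2 hε⟩⟩
  · rintro s _ ⟨𝒟, hc, hm, h⟩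
    refine ⟨compl '' 𝒟, hc.image _, ?_, fun w ε hε => ?_⟩
    · rintro _ ⟨D, hD, rfl⟩
      exact (hm D hD).compl
    · obtain ⟨D, hD, hlt⟩ := h w ε hε
      refine ⟨Dᶜ, ⟨D, hD, rfl⟩, ?_⟩
      have : {x | (x, w) ∈ sᶜ} = {x | (x, w) ∈ s}ᶜ := rfl
      rwa [this, compl_symmDiff_compl]
  · intro s hs h
    choose 𝒟 hc hm h using h
    -- Finite unions of approximants stay countable in number. Half of `ε` pays for truncating the
    -- union of sections, the other half for the summable errors `ε' i`.
    refine ⟨Set.sUnion '' {F | F.Finite ∧ F ⊆ ⋃ i, 𝒟 i},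
      (Set.countable_ofPred_finite_subset (Set.countable_iUnion hc)).image _, ?_, fun w ε hε => ?_⟩
    · rintro _ ⟨F, ⟨hF, hsub⟩, rfl⟩
      refine MeasurableSet.sUnion hF.countable fun D hD => ?_
      obtain ⟨i, hi⟩ := Set.mem_iUnion.1 (hsub hD)
      exact hm i D hi
    · have hsm : ∀ i, MeasurableSet (s i) := fun i => by
        have := hs i; rwa [generateFrom_prod] at this
      set S : ℕ → Set X := fun i => {x | (x, w) ∈ s i} with hS
      have hSm : ∀ i, MeasurableSet (S i) := fun i => measurable_prodMk_right (hsm i)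
      have hε2 : ε / 2 ≠ 0 := by simpa using hε
      obtain ⟨ε', hε'pos, hε'⟩ := ENNReal.exists_pos_sum_of_countable' hε2 ℕ
      choose D hD hDlt using fun i => h i w (ε' i) (hε'pos i).ne'
      have htail : ∃ N, P ((⋃ i, S i) \ Set.accumulate S N) < ε / 2 := by
        have hanti : Antitone fun N => (⋃ i, S i) \ Set.accumulate S N := fun a b hab =>
          Set.sdiff_subset_sdiff_right (Set.monotone_accumulate hab)
        have ht := tendsto_measure_iInter_atTop (μ := P)
          (s := fun N => (⋃ i, S i) \ Set.accumulate S N)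
          (fun N => ((MeasurableSet.iUnion hSm).diff
            (MeasurableSet.biUnion (Set.to_countable _) fun i _ => hSm i)).nullMeasurableSet) hanti ⟨0, measure_ne_top _ _⟩
        have he : (⋂ N, (⋃ i, S i) \ Set.accumulate S N) = ∅ := by
          rw [← Set.sdiff_iUnion, Set.iUnion_accumulate, Set.sdiff_self]
        rw [he, measure_empty] at ht
        exact ((tendsto_order.1 ht).2 _ (pos_iff_ne_zero.2 hε2)).exists
      obtain ⟨N, hN⟩ := htail
      refine ⟨⋃₀ (D '' Set.Iic N), ⟨_, ⟨(Set.finite_Iic N).image D, ?_⟩, rfl⟩, ?_⟩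
      · rintro _ ⟨i, -, rfl⟩
        exact Set.mem_iUnion.2 ⟨i, hD i⟩
      · have hsub : symmDiff {x | (x, w) ∈ ⋃ i, s i} (⋃₀ (D '' Set.Iic N)) ⊆
            ((⋃ i, S i) \ Set.accumulate S N) ∪ ⋃ i, symmDiff (S i) (D i) := by
          intro x hx
          simp only [Set.mem_symmDiff, Set.mem_ofPred_eq, Set.mem_iUnion, Set.mem_sUnion,
            Set.mem_image, Set.mem_Iic, Set.mem_union, Set.mem_sdiff, Set.mem_accumulate, hS]
            at hx ⊢
          grind
        calc _ ≤ _ := measure_mono hsub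
          _ ≤ P ((⋃ i, S i) \ Set.accumulate S N) + P (⋃ i, symmDiff (S i) (D i)) :=
            measure_union_le _ _
          _ < ε / 2 + ε / 2 := by
            refine ENNReal.add_lt_add hN (((measure_iUnion_le _).trans ?_).trans_lt hε')
            exact ENNReal.tsum_le_tsum fun i => (hDlt i).le
          _ = ε := ENNReal.add_halves ε

/-- The pseudo-distances between sections of a measurable set are small on a measurable set of
pairs almost all of whose sections have positive measure. -/
theorem exists_close_pairs (P : Measure X) [IsFiniteMeasure P] (μ : Measure Ω)
    {C : Set (X × Ω)} (hC : MeasurableSet C) {ε : ℝ≥0∞} (hε : ε ≠ 0) :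
    ∃ R : Set (Ω × Ω), MeasurableSet R ∧
      (∀ w v, (w, v) ∈ R → P (symmDiff {x | (x, w) ∈ C} {x | (x, v) ∈ C}) ≤ ε) ∧
      ∀ᵐ w ∂μ, μ (Prod.mk w ⁻¹' R) ≠ 0 := by
  obtain ⟨𝒟, hc, hm, h⟩ := exists_countable_approx_sections P hC
  have hε2 : ε / 2 ≠ 0 := by simpa using hε
  set T : Set X → Set Ω := fun D => {w | P (symmDiff {x | (x, w) ∈ C} D) < ε / 2} with hT
  have hTm : ∀ D ∈ 𝒟, MeasurableSet (T D) := fun D hD => by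
    have hS : MeasurableSet (symmDiff C (D ×ˢ Set.univ)) :=
      hC.symmDiff ((hm D hD).prod MeasurableSet.univ)
    have := measurable_measure_prodMk_right (μ := P) hS
    have he : T D = (fun w => P ((fun x => (x, w)) ⁻¹' symmDiff C (D ×ˢ Set.univ))) ⁻¹'
        Set.Iio (ε / 2) := by
      ext w
      have : (fun x => (x, w)) ⁻¹' symmDiff C (D ×ˢ Set.univ) = symmDiff {x | (x, w) ∈ C} D := by
        ext x; simp [Set.mem_symmDiff]
      rw [Set.mem_preimage, this]; rfl
    rw [he]
    exact this measurableSet_Iio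
  -- Pairs are declared close when both sections lie within `ε / 2` of a common `D`. The section of
  -- this set at `w` contains every `T D` with `w ∈ T D`, so it can be null only if `w` lies in one
  -- of the countably many null `T D`.
  refine ⟨⋃ D ∈ 𝒟, T D ×ˢ T D, MeasurableSet.biUnion hc fun D hD => (hTm D hD).prod (hTm D hD),
    ?_, ?_⟩
  · intro w v hwv
    simp only [Set.mem_iUnion, Set.mem_prod] at hwv
    obtain ⟨D, hD, hw, hv⟩ := hwv
    calc _ ≤ P (symmDiff {x | (x, w) ∈ C} D ∪ symmDiff D {x | (x, v) ∈ C}) :=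
          measure_mono (symmDiff_triangle _ _ _)
      _ ≤ _ := measure_union_le _ _
      _ ≤ ε / 2 + ε / 2 := by
        refine add_le_add (le_of_lt hw) ?_
        rw [symmDiff_comm]
        exact le_of_lt hv
      _ = ε := ENNReal.add_halves ε
  · have hnull : μ (⋃ D ∈ {D ∈ 𝒟 | μ (T D) = 0}, T D) = 0 :=
      (measure_biUnion_null_iff (hc.mono fun D hD => hD.1)).2 fun D hD => hD.2
    filter_upwards [measure_eq_zero_iff_ae_notMem.1 hnull] with w hw h0
    obtain ⟨D, hD, hlt⟩ := h w _ hε2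
    refine hw (Set.mem_biUnion (x := D) ⟨hD, measure_mono_null ?_ h0⟩ hlt)
    intro v hv
    exact Set.mem_biUnion hD ⟨hlt, hv⟩

end Sections

/-! ### From sensitivity in expectation to almost sure sensitivity -/

section Conditioning

variable {Ω : Type*} [MeasurableSpace Ω]

/-- Conditioning a measure on the sections of a measurable set, as a kernel. -/
def sectionCond (μ : Measure Ω) [IsFiniteMeasure μ] (S : Set (Ω × Ω)) (hS : MeasurableSet S) :
    Kernel Ω Ω where
  toFun w := ProbabilityTheory.cond μ (Prod.mk w ⁻¹' S)
  measurable' := by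
    refine Measure.measurable_of_measurable_coe _ fun t ht => ?_
    have h : ∀ w, ProbabilityTheory.cond μ (Prod.mk w ⁻¹' S) t =
        (μ (Prod.mk w ⁻¹' S))⁻¹ * μ (Prod.mk w ⁻¹' (S ∩ Set.univ ×ˢ t)) := fun w => by
      rw [ProbabilityTheory.cond_apply (measurable_prodMk_left hS)]
      congr 2
      ext v; simp
    simp_rw [h]
    exact (measurable_measure_prodMk_left hS).inv.mul
      (measurable_measure_prodMk_left (hS.inter (MeasurableSet.univ.prod ht)))

theorem sectionCond_apply (μ : Measure Ω) [IsFiniteMeasure μ] (S : Set (Ω × Ω))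
    (hS : MeasurableSet S) (w : Ω) :
    sectionCond μ S hS w = ProbabilityTheory.cond μ (Prod.mk w ⁻¹' S) := rfl

/-- Conditioning on a null section gives the zero measure, so the kernel is Markov only when all
sections have positive mass. -/
instance (μ : Measure Ω) [IsFiniteMeasure μ] (S : Set (Ω × Ω)) (hS : MeasurableSet S) :
    IsFiniteKernel (sectionCond μ S hS) := by
  refine ⟨1, ENNReal.one_lt_top, fun w => ?_⟩
  rw [sectionCond_apply]
  by_cases h : μ (Prod.mk w ⁻¹' S) = 0
  · simp [cond_eq_zero_of_meas_eq_zero h]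
  · have := cond_isProbabilityMeasure h
    exact prob_le_one

/-- If `∫∫ δ ≤ ∫∫ ρ` for all conditional laws that are absolutely continuous with respect to `μ`,
and `ρ` is arbitrarily small near the diagonal, then `δ ≤ ρ` almost everywhere. -/
theorem ae_le_of_forall_kernel (μ : Measure Ω) [IsProbabilityMeasure μ] (ρ δ : Ω × Ω → ℝ≥0∞)
    (hρ : Measurable ρ) (hδ : Measurable δ) (hρ1 : ∀ z, ρ z ≤ 1)
    (hclose : ∀ ε : ℝ≥0∞, ε ≠ 0 → ∃ R : Set (Ω × Ω), MeasurableSet R ∧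
      (∀ w v, (w, v) ∈ R → ρ (w, v) ≤ ε) ∧ ∀ᵐ w ∂μ, μ (Prod.mk w ⁻¹' R) ≠ 0)
    (H : ∀ V : Kernel Ω Ω, IsMarkovKernel V → (∀ w, V w ≪ μ) →
      ∫⁻ w, ∫⁻ v, δ (w, v) ∂(V w) ∂μ ≤ ∫⁻ w, ∫⁻ v, ρ (w, v) ∂(V w) ∂μ) :
    ∀ᵐ z ∂(μ.prod μ), δ z ≤ ρ z := by
  set B : Set (Ω × Ω) := {z | ρ z < δ z} with hB
  have hBm : MeasurableSet B := measurableSet_lt hρ hδ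
  set N : Set Ω := {w | μ (Prod.mk w ⁻¹' B) ≠ 0} with hN
  have hNm : MeasurableSet N := (measurable_measure_prodMk_left hBm) (measurableSet_singleton 0).compl
  set a : Ω → ℝ≥0∞ := fun w => ∫⁻ v, δ (w, v) ∂(sectionCond μ B hBm w) with ha
  set b : Ω → ℝ≥0∞ := fun w => ∫⁻ v, ρ (w, v) ∂(sectionCond μ B hBm w) with hb
  have hb1 : ∀ w ∈ N, b w ≤ 1 := fun w hw => by
    have : IsProbabilityMeasure (sectionCond μ B hBm w) := cond_isProbabilityMeasure hw
    calc b w ≤ ∫⁻ _, 1 ∂(sectionCond μ B hBm w) := lintegral_mono fun v => hρ1 _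
      _ = 1 := by simp
  have hlt : ∀ w ∈ N, b w < a w := fun w hw => by
    have hP : IsProbabilityMeasure (sectionCond μ B hBm w) := cond_isProbabilityMeasure hw
    refine lintegral_strict_mono (IsProbabilityMeasure.ne_zero _)
      (hδ.comp measurable_prodMk_left).aemeasurable ((hb1 w hw).trans_lt ENNReal.one_lt_top).ne ?_
    exact ae_cond_mem (measurable_prodMk_left hBm)
  have hle : ∀ ε : ℝ≥0∞, ε ≠ 0 → ∫⁻ w in N, a w ∂μ ≤ ∫⁻ w in N, b w ∂μ + ε := by
    intro ε hε
    obtain ⟨R, hRm, hRε, hRpos⟩ := hclose ε hε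
    set M : Set Ω := {w | μ (Prod.mk w ⁻¹' R) ≠ 0} with hM
    have hMm : MeasurableSet M :=
      (measurable_measure_prodMk_left hRm) (measurableSet_singleton 0).compl
    -- The test law concentrates on the violating set `B` when `w ∈ N`. For other `w` it sits where
    -- `ρ ≤ ε`, so those `w` add at most `ε` to the right side, while their contribution to the left
    -- is simply dropped. The third piece treats the null set where `R` has null sections and only
    -- ensures that the kernel is Markov.
    set S : Set (Ω × Ω) := (B ∩ N ×ˢ Set.univ) ∪ (R ∩ (M \ N) ×ˢ Set.univ) ∪
      ((Mᶜ \ N) ×ˢ Set.univ) with hS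
    have hSm : MeasurableSet S := by
      refine ((hBm.inter (hNm.prod MeasurableSet.univ)).union
        (hRm.inter ((hMm.diff hNm).prod MeasurableSet.univ))).union
        ((hMm.compl.diff hNm).prod MeasurableSet.univ)
    have hS1 : ∀ w ∈ N, Prod.mk w ⁻¹' S = Prod.mk w ⁻¹' B := fun w hw => by
      ext v; simp [hS, hw]
    have hS2 : ∀ w ∈ Nᶜ, w ∈ M → Prod.mk w ⁻¹' S = Prod.mk w ⁻¹' R := fun w hw hw' => by
      have hw : w ∉ N := hw
      ext v; simp [hS, hw, hw']
    have hS3 : ∀ w ∈ Nᶜ, w ∉ M → Prod.mk w ⁻¹' S = Set.univ := fun w hw hw' => by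
      have hw : w ∉ N := hw
      ext v; simp [hS, hw, hw']
    have hpos : ∀ w, μ (Prod.mk w ⁻¹' S) ≠ 0 := fun w => by
      by_cases h1 : w ∈ N
      · rw [hS1 w h1]; exact h1
      by_cases h2 : w ∈ M
      · rw [hS2 w h1 h2]; exact h2
      · rw [hS3 w h1 h2]; simp
    have hMk : IsMarkovKernel (sectionCond μ S hSm) :=
      ⟨fun w => cond_isProbabilityMeasure (hpos w)⟩
    have key := H (sectionCond μ S hSm) hMk fun w => cond_absolutelyContinuous
    have hmeas : Measurable fun w => ∫⁻ v, ρ (w, v) ∂(sectionCond μ S hSm w) :=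
      hρ.lintegral_kernel_prod_right'
    calc ∫⁻ w in N, a w ∂μ = ∫⁻ w in N, ∫⁻ v, δ (w, v) ∂(sectionCond μ S hSm w) ∂μ :=
          setLIntegral_congr_fun hNm fun w hw => by
            simp only [ha, sectionCond_apply, hS1 w hw]
      _ ≤ ∫⁻ w, ∫⁻ v, δ (w, v) ∂(sectionCond μ S hSm w) ∂μ := setLIntegral_le_lintegral _ _
      _ ≤ ∫⁻ w, ∫⁻ v, ρ (w, v) ∂(sectionCond μ S hSm w) ∂μ := key
      _ = ∫⁻ w in N, ∫⁻ v, ρ (w, v) ∂(sectionCond μ S hSm w) ∂μ +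
          ∫⁻ w in Nᶜ, ∫⁻ v, ρ (w, v) ∂(sectionCond μ S hSm w) ∂μ :=
          (lintegral_add_compl _ hNm).symm
      _ ≤ ∫⁻ w in N, b w ∂μ + ε := by
        refine add_le_add (le_of_eq ?_) ?_
        · exact setLIntegral_congr_fun hNm fun w hw => by
            simp only [hb, sectionCond_apply, hS1 w hw]
        · calc _ ≤ ∫⁻ w in Nᶜ, ε ∂μ := by
                refine lintegral_mono_ae ?_
                filter_upwards [ae_restrict_mem hNm.compl, ae_restrict_of_ae hRpos] with w h1 h2
                have hP : IsProbabilityMeasure (sectionCond μ R hRm w) :=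
                  cond_isProbabilityMeasure h2
                have he : sectionCond μ S hSm w = sectionCond μ R hRm w := by
                  rw [sectionCond_apply, sectionCond_apply, hS2 w h1 h2]
                rw [he]
                calc _ ≤ ∫⁻ _, ε ∂(sectionCond μ R hRm w) := by
                      refine lintegral_mono_ae ?_
                      filter_upwards [ae_cond_mem (μ := μ) (measurable_prodMk_left (x := w) hRm)]
                        with v hv
                      exact hRε w v hv
                  _ = ε := by simp
            _ ≤ ε := by
                rw [setLIntegral_const]
                exact mul_le_of_le_one_right' prob_le_one
  have hle' : ∫⁻ w in N, a w ∂μ ≤ ∫⁻ w in N, b w ∂μ :=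
    ENNReal.le_of_forall_pos_le_add fun ε hε _ => hle ε (by exact_mod_cast hε.ne')
  have hfin : ∫⁻ w in N, b w ∂μ ≠ ∞ := by
    refine ((setLIntegral_mono' hNm hb1).trans ?_).trans_lt ENNReal.one_lt_top |>.ne
    simpa using prob_le_one
  -- On `N` the conditional mean of `δ` strictly exceeds that of `ρ`, so positive mass of `N` would
  -- contradict `hle'`.
  have hN0 : μ N = 0 := by
    by_contra h
    have := setLIntegral_strict_mono hNm h (hδ.lintegral_kernel_prod_right' (κ := sectionCond μ B hBm)) hfin
      (Filter.Eventually.of_forall hlt)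
    exact absurd hle' (not_le.2 this)
  have : (μ.prod μ) B = 0 := by
    rw [Measure.measure_prod_null hBm]
    filter_upwards [measure_eq_zero_iff_ae_notMem.1 hN0] with w hw
    simpa [hN] using hw
  rw [ae_iff]
  simpa [hB] using this

end Conditioning

/-! ### Volume of sets of small essential diameter -/

/-- An almost-everywhere distance bound holds everywhere on the support: two support points further
apart would have neighbourhoods whose product has positive mass. In the sup norm, volume is at most
diameter to the power `d`, with constant one. -/
theorem measure_univ_le_pow_of_ae_edist_le {d : ℕ} {ν : Measure (Fin d → ℝ)} [SFinite ν]
    (hν : ν ≤ volume) (D : ℝ≥0∞) (h : ∀ᵐ z ∂(ν.prod ν), edist z.1 z.2 ≤ D) :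
    ν Set.univ ≤ D ^ d := by
  have hdiam : Metric.ediam ν.support ≤ D := by
    refine Metric.ediam_le fun a ha b hb => ?_
    by_contra hab
    have hopen : IsOpen {z : (Fin d → ℝ) × (Fin d → ℝ) | D < edist z.1 z.2} :=
      isOpen_lt continuous_const (by fun_prop)
    have hmem : {z : (Fin d → ℝ) × (Fin d → ℝ) | D < edist z.1 z.2} ∈ nhds (a, b) :=
      hopen.mem_nhds (not_le.1 hab)
    obtain ⟨U, hU, V, hV, hUV⟩ := mem_nhds_prod_iff.1 hmem
    have h0 : (ν.prod ν) (U ×ˢ V) = 0 := by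
      refine measure_mono_null ?_ (ae_iff.1 h)
      intro z hz
      exact not_le.2 (hUV hz)
    rw [Measure.prod_prod] at h0
    have h1 := (Measure.mem_support_iff_forall a).1 ha U hU
    have h2 := (Measure.mem_support_iff_forall b).1 hb V hV
    rcases mul_eq_zero.1 h0 with h | h
    exacts [h1.ne' h, h2.ne' h]
  calc ν Set.univ ≤ ν ν.support + ν ν.supportᶜ := by
        rw [← Set.union_compl_self ν.support]; exact measure_union_le _ _
    _ = ν ν.support := by rw [Measure.measure_compl_support, add_zero]
    _ ≤ volume ν.support := hν _
    _ ≤ Metric.ediam ν.support ^ Fintype.card (Fin d) := Real.volume_pi_le_diam_pow _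
    _ ≤ D ^ d := by rw [Fintype.card_fin]; gcongr

/-! ### Exponential integrals from volume growth -/

theorem lintegral_exp_neg_mul_Ici {s : ℝ} (hs : 0 < s) (c : ℝ) :
    ∫⁻ r in Set.Ici c, ENNReal.ofReal (s * Real.exp (-s * r)) =
      ENNReal.ofReal (Real.exp (-s * c)) := by
  rw [setLIntegral_congr Ioi_ae_eq_Ici.symm, ← ofReal_integral_eq_lintegral_ofReal]
  · rw [integral_const_mul, integral_exp_mul_Ioi (by linarith)]
    congr 1
    field_simp
  · exact (integrableOn_exp_mul_Ioi (by linarith) c).const_mul s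
  · exact Filter.Eventually.of_forall fun r => by positivity

theorem lintegral_pow_mul_exp {s K : ℝ} (hs : 0 < s) (hK : 0 ≤ K) (d : ℕ) :
    ∫⁻ r in Set.Ioi (0 : ℝ), ENNReal.ofReal ((K * r) ^ d * (s * Real.exp (-s * r))) =
      ENNReal.ofReal (d.factorial * (K / s) ^ d) := by
  have hd : (0 : ℝ) < (d : ℝ) + 1 := by positivity
  have hf : ∀ r ∈ Set.Ioi (0 : ℝ), (K * r) ^ d * (s * Real.exp (-s * r)) =
      (K ^ d * s) * (r ^ ((d : ℝ) + 1 - 1) * Real.exp (-(s * r))) := fun r hr => by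
    rw [add_sub_cancel_right, Real.rpow_natCast, mul_pow, neg_mul]; ring
  have hint : IntegrableOn (fun r : ℝ => (K * r) ^ d * (s * Real.exp (-s * r))) (Set.Ioi 0) := by
    refine (integrableOn_congr_fun hf measurableSet_Ioi).2 ?_
    refine Integrable.const_mul ?_ _
    have := integrableOn_rpow_mul_exp_neg_mul_rpow (s := (d : ℝ)) (p := 1) (b := s)
      (by linarith) one_pos hs
    simpa [IntegrableOn] using this
  rw [← ofReal_integral_eq_lintegral_ofReal hint]
  · rw [setIntegral_congr_fun measurableSet_Ioi hf, integral_const_mul,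
      Real.integral_rpow_mul_exp_neg_mul_Ioi hd hs, Real.Gamma_nat_eq_factorial]
    congr 1
    rw [show ((d : ℝ) + 1) = ((d + 1 : ℕ) : ℝ) by push_cast; rfl, Real.rpow_natCast, div_pow, div_pow,
      one_pow]
    field_simp
    ring
  · filter_upwards [ae_restrict_mem measurableSet_Ioi] with r hr
    have : 0 < r := hr
    simp only [Pi.zero_apply]
    positivity

/-- If the sublevel sets of `ρ` have volume at most `(K r)^d` then
`∫ exp (-s ρ) ≤ d! (K / s)^d`. -/
theorem lintegral_exp_neg_le {Ω : Type*} [MeasurableSpace Ω] (ν : Measure Ω) [SFinite ν]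
    {ρ : Ω → ℝ} (hρ : Measurable ρ) (hρ0 : ∀ w, 0 ≤ ρ w) {s K : ℝ} (hs : 0 < s) (hK : 0 ≤ K)
    {d : ℕ} (hvol : ∀ r, 0 < r → ν {w | ρ w ≤ r} ≤ ENNReal.ofReal (K * r) ^ d) :
    ∫⁻ w, ENNReal.ofReal (Real.exp (-s * ρ w)) ∂ν ≤
      ENNReal.ofReal (d.factorial * (K / s) ^ d) := by
  -- Layer cake: `exp (-s ρ)` is the integral of `s exp (-s r)` over `r ≥ ρ`; Tonelli then exposes
  -- the sublevel volumes.
  have h1 : ∀ w, ENNReal.ofReal (Real.exp (-s * ρ w)) = ∫⁻ r in Set.Ioi (0 : ℝ),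
      {z : Ω × ℝ | ρ z.1 ≤ z.2}.indicator
        (fun z => ENNReal.ofReal (s * Real.exp (-s * z.2))) (w, r) := fun w => by
    rw [← lintegral_exp_neg_mul_Ici hs, setLIntegral_congr Ioi_ae_eq_Ici,
      ← lintegral_indicator measurableSet_Ici, ← lintegral_indicator measurableSet_Ici]
    refine lintegral_congr fun r => ?_
    by_cases h : ρ w ≤ r
    · simp [Set.indicator, h, (hρ0 w).trans h]
    · simp [Set.indicator, h]
  simp_rw [h1]
  have hset : MeasurableSet {z : Ω × ℝ | ρ z.1 ≤ z.2} :=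
    measurableSet_le (hρ.comp measurable_fst) measurable_snd
  rw [lintegral_lintegral_swap]
  · rw [← lintegral_pow_mul_exp hs hK d]
    refine setLIntegral_mono' measurableSet_Ioi fun r hr => ?_
    have hr : 0 < r := hr
    have h2 : ∀ w, {z : Ω × ℝ | ρ z.1 ≤ z.2}.indicator
        (fun z => ENNReal.ofReal (s * Real.exp (-s * z.2))) (w, r) =
        {w | ρ w ≤ r}.indicator (fun _ => ENNReal.ofReal (s * Real.exp (-s * r))) w := fun w => by
      simp [Set.indicator]
    simp_rw [h2]
    rw [lintegral_indicator (measurableSet_le hρ measurable_const), setLIntegral_const,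
      ENNReal.ofReal_mul (p := (K * r) ^ d) (by positivity), ENNReal.ofReal_pow (by positivity),
      mul_comm]
    gcongr
    exact hvol r hr
  · exact (Measurable.indicator (by fun_prop) hset).aemeasurable

/-! ### The number of label patterns -/

/-- With `q = d/n ≤ 1`, replacing `q ^ d` by the larger `q ^ k` and completing the binomial sum
gives `(1 + q) ^ n ≤ exp d`. For `d = 0` both sides equal one, since `x / 0 = 0` and `0 ^ 0 = 1`. -/
theorem sum_choose_le_exp_pow {d n : ℕ} (h : d ≤ n) :
    (∑ k ∈ Finset.Iic d, (n.choose k : ℝ)) ≤ (Real.exp 1 * n / d) ^ d := by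
  rcases Nat.eq_zero_or_pos d with rfl | hd
  · have : (Finset.Iic 0 : Finset ℕ) = {0} := rfl
    simp [this]
  have hd' : (0 : ℝ) < d := by exact_mod_cast hd
  have hn : (0 : ℝ) < n := by exact_mod_cast hd.trans_le h
  set q : ℝ := d / n with hq
  have hq0 : 0 < q := by positivity
  have hq1 : q ≤ 1 := by rw [hq, div_le_one hn]; exact_mod_cast h
  have h1 : q ^ d * ∑ k ∈ Finset.Iic d, (n.choose k : ℝ) ≤ Real.exp d := by
    calc q ^ d * ∑ k ∈ Finset.Iic d, (n.choose k : ℝ)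
        ≤ ∑ k ∈ Finset.Iic d, q ^ k * (n.choose k : ℝ) := by
          rw [Finset.mul_sum]
          refine Finset.sum_le_sum fun k hk => ?_
          exact mul_le_mul_of_nonneg_right
            (pow_le_pow_of_le_one hq0.le hq1 (Finset.mem_Iic.1 hk)) (by positivity)
      _ ≤ ∑ k ∈ Finset.range (n + 1), q ^ k * (n.choose k : ℝ) := by
          refine Finset.sum_le_sum_of_subset_of_nonneg (fun k hk => ?_) fun k _ _ => by positivity
          have := Finset.mem_Iic.1 hk
          exact Finset.mem_range.2 (by omega)
      _ = (q + 1) ^ n := by rw [add_pow]; simp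
      _ ≤ Real.exp q ^ n := by gcongr; exact Real.add_one_le_exp q
      _ = Real.exp d := by
          rw [← Real.exp_nat_mul]; congr 1; rw [hq]; field_simp
  have h2 : (Real.exp 1 * n / d) ^ d = Real.exp d / q ^ d := by
    rw [hq, ← Real.exp_one_pow, ← div_pow]; congr 1; field_simp
  rw [h2, le_div_iff₀ (by positivity), mul_comm]
  exact h1

/-- The patterns produced on the sample `x` by the classifiers `c · w`. -/
def patterns {X Ω : Type*} {n : ℕ} (c : X → Ω → Bool) (x : Fin n → X) : Finset (Fin n → Bool) :=
  open Classical in Finset.univ.filter fun y => ∃ w, y = fun i => c (x i) w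

theorem mem_patterns {X Ω : Type*} {n : ℕ} (c : X → Ω → Bool) (x : Fin n → X) (w : Ω) :
    (fun i => c (x i) w) ∈ patterns c x := by
  simp only [patterns, Finset.mem_filter, Finset.mem_univ, true_and]
  exact ⟨w, rfl⟩

/-- The Sauer-Shelah bound on the number of patterns. -/
theorem card_patterns_le {X Ω : Type*} {n D : ℕ} (c : X → Ω → Bool)
    (hD : ∀ s : Finset X, (∀ t : Set X, t ⊆ s → ∃ w, (s : Set X) ∩ {x | c x w = true} = t) →
      s.card ≤ D) (x : Fin n → X) :
    (patterns c x).card ≤ ∑ k ∈ Finset.Iic D, n.choose k := by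
  classical
  set φ : (Fin n → Bool) → Finset (Fin n) := fun y => Finset.univ.filter fun i => y i = true with hφ
  have hinj : Function.Injective φ := fun y y' h => by
    funext i
    have : i ∈ φ y ↔ i ∈ φ y' := by rw [h]
    simp only [hφ, Finset.mem_filter, Finset.mem_univ, true_and] at this
    exact Bool.eq_iff_iff.2 this
  set 𝒜 : Finset (Finset (Fin n)) := (patterns c x).image φ with h𝒜
  have hcard : (patterns c x).card = 𝒜.card := (Finset.card_image_of_injective _ hinj).symm
  have hsh : ∀ S : Finset (Fin n), 𝒜.Shatters S → S.card ≤ D := by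
    intro S hS
    have hreal : ∀ T ⊆ S, ∃ w, ∀ i ∈ S, c (x i) w = true ↔ i ∈ T := by
      intro T hT
      obtain ⟨u, hu, hSu⟩ := hS hT
      obtain ⟨y, hy, rfl⟩ := Finset.mem_image.1 hu
      simp only [patterns, Finset.mem_filter, Finset.mem_univ, true_and] at hy
      obtain ⟨w, rfl⟩ := hy
      refine ⟨w, fun i hi => ?_⟩
      rw [← hSu]
      simp [hφ, hi]
    -- Inputs may repeat in the sample, but not on shattered indices: the trace `{i}` separates `i`
    -- from every other index. Shattered indices thus correspond to equally many shattered inputs.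
    have hxinj : Set.InjOn x S := by
      intro i hi j hj hij
      obtain ⟨w, hw⟩ := hreal {i} (by simpa using hi)
      have h1 := (hw i hi).2 (by simp)
      rw [hij] at h1
      exact (Finset.mem_singleton.1 ((hw j hj).1 h1)).symm
    rw [← Finset.card_image_of_injOn hxinj]
    refine hD _ fun t ht => ?_
    obtain ⟨w, hw⟩ := hreal (S.filter fun i => x i ∈ t) (Finset.filter_subset _ _)
    refine ⟨w, ?_⟩
    ext a
    constructor
    · rintro ⟨ha, haw⟩
      obtain ⟨i, hi, rfl⟩ := Finset.mem_image.1 (Finset.mem_coe.1 ha)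
      exact (Finset.mem_filter.1 ((hw i hi).1 haw)).2
    · intro ha
      refine ⟨ht ha, ?_⟩
      obtain ⟨i, hi, rfl⟩ := Finset.mem_image.1 (Finset.mem_coe.1 (ht ha))
      exact (hw i hi).2 (Finset.mem_filter.2 ⟨hi, ha⟩)
  have hvc : 𝒜.vcDim ≤ D := Finset.sup_le fun S hS => hsh S (Finset.mem_shatterer.1 hS)
  rw [hcard]
  calc 𝒜.card ≤ 𝒜.shatterer.card := Finset.card_le_card_shatterer 𝒜
    _ ≤ ∑ k ∈ Finset.Iic 𝒜.vcDim, (Fintype.card (Fin n)).choose k :=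
      Finset.card_shatterer_le_sum_vcDim
    _ ≤ ∑ k ∈ Finset.Iic D, n.choose k := by
      rw [Fintype.card_fin]
      exact Finset.sum_le_sum_of_subset (Finset.Iic_subset_Iic.2 hvc)

/-! ### Product kernels -/

section PiKernel

variable {ι Ω E F : Type*} [Fintype ι] [MeasurableSpace Ω] [MeasurableSpace E] [MeasurableSpace F]

/-- The product `ω ↦ ⨂ i, κ i ω` of finitely many Markov kernels. -/
def piKernel (κ : ι → Kernel Ω E) [∀ i, IsMarkovKernel (κ i)] : Kernel Ω (ι → E) where
  toFun ω := Measure.pi fun i => κ i ω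
  measurable' := by
    refine Measurable.measure_of_isPiSystem_of_isProbabilityMeasure generateFrom_pi.symm
      isPiSystem_pi ?_
    rintro _ ⟨s, hs, rfl⟩
    simp_rw [Measure.pi_pi]
    exact Finset.measurable_prod _ fun i _ => (κ i).measurable_coe (hs i (Set.mem_univ i))

theorem piKernel_apply (κ : ι → Kernel Ω E) [∀ i, IsMarkovKernel (κ i)] (ω : Ω) :
    piKernel κ ω = Measure.pi fun i => κ i ω := rfl

instance (κ : ι → Kernel Ω E) [∀ i, IsMarkovKernel (κ i)] : IsMarkovKernel (piKernel κ) :=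
  ⟨fun ω => by rw [piKernel_apply]; infer_instance⟩

/-- A product of mixtures is a mixture of products. -/
theorem pi_bind (P : Measure E) [IsProbabilityMeasure P] (η : Kernel E F) [IsMarkovKernel η] :
    Measure.pi (fun _ : ι => P.bind η) =
      (Measure.pi fun _ : ι => P).bind
        (piKernel fun i : ι => η.comap (fun x : ι → E => x i) (measurable_pi_apply i)) := by
  have : IsProbabilityMeasure (P.bind η) := by
    constructor
    rw [Measure.bind_apply MeasurableSet.univ η.aemeasurable]
    simp
  symm
  refine (Measure.pi_eq fun s hs => ?_).symm
  rw [Measure.bind_apply (MeasurableSet.univ_pi hs) (Kernel.aemeasurable _)]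
  simp_rw [piKernel_apply, Measure.pi_pi, Kernel.comap_apply]
  -- Under the product law the coordinates are independent, so the integral of the product factors.
  have hind : iIndepFun (fun (i : ι) (x : ι → E) => η (x i) (s i)) (Measure.pi fun _ : ι => P) :=
    iIndepFun_pi (X := fun i x => η x (s i)) fun i => (η.measurable_coe (hs i)).aemeasurable
  rw [lintegral_prod_eq_prod_lintegral_of_indepFun Finset.univ _ hind
    fun i => (η.measurable_coe (hs i)).comp (measurable_pi_apply i)]
  refine Finset.prod_congr rfl fun i _ => ?_
  rw [Measure.bind_apply (hs i) η.aemeasurable]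
  exact (measurePreserving_eval (fun _ : ι => P) i).lintegral_comp (η.measurable_coe (hs i))

end PiKernel

/-! ### Deterministic labels and the noise channel -/

section Channel

variable {X Ω : Type*} [MeasurableSpace X] [MeasurableSpace Ω]

/-- The channel that keeps the input and corrupts the label. -/
def noiseChannel (noise : Kernel (X × Bool) Bool) : Kernel (X × Bool) (X × Bool) :=
  (Kernel.deterministic Prod.fst measurable_fst) ×ₖ noise

instance (noise : Kernel (X × Bool) Bool) [IsMarkovKernel noise] :
    IsMarkovKernel (noiseChannel noise) := by
  unfold noiseChannel; infer_instance

/-- The law of the estimate, given the inputs and the clean labels. -/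
def estimateKernel {n : ℕ} (noise : Kernel (X × Bool) Bool) [IsMarkovKernel noise]
    (Q : Kernel (Fin n → X × Bool) Ω) : Kernel (Fin n → X × Bool) Ω :=
  Q ∘ₖ piKernel fun i : Fin n => (noiseChannel noise).comap
    (fun z : Fin n → X × Bool => z i) (measurable_pi_apply i)

instance {n : ℕ} (noise : Kernel (X × Bool) Bool) [IsMarkovKernel noise]
    (Q : Kernel (Fin n → X × Bool) Ω) [IsMarkovKernel Q] :
    IsMarkovKernel (estimateKernel noise Q) := by
  unfold estimateKernel; infer_instance

/-- The law of a noisy sample as a mixture over the inputs. -/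
theorem compProd_noise_eq_bind (PX : Measure X) [IsProbabilityMeasure PX]
    (noise : Kernel (X × Bool) Bool) [IsMarkovKernel noise] (c : X → Bool) (hc : Measurable c) :
    PX ⊗ₘ noise.comap (fun x => (x, c x)) (by fun_prop) =
      PX.bind ((noiseChannel noise).comap (fun x => (x, c x)) (by fun_prop)) := by
  ext s hs
  rw [Measure.compProd_apply hs, Measure.bind_apply hs (Kernel.aemeasurable _)]
  refine lintegral_congr fun x => ?_
  rw [Kernel.comap_apply, Kernel.comap_apply, noiseChannel, Kernel.prod_apply,
    Kernel.deterministic_apply, Measure.dirac_prod, Measure.map_apply (by fun_prop) hs]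

/-- Isolates the clean labels as the only route from the classifier to the estimate: draw the
inputs, label them by `c`, then apply a kernel that does not involve `c`. -/
theorem lintegral_pi_compProd_noise {n : ℕ} (PX : Measure X) [IsProbabilityMeasure PX]
    (noise : Kernel (X × Bool) Bool) [IsMarkovKernel noise] (c : X → Bool) (hc : Measurable c)
    (Q : Kernel (Fin n → X × Bool) Ω) {g : Ω → ℝ≥0∞} (hg : Measurable g) :
    ∫⁻ zs, ∫⁻ v, g v ∂(Q zs) ∂(Measure.pi fun _ : Fin n =>
        PX ⊗ₘ noise.comap (fun x => (x, c x)) (by fun_prop)) =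
      ∫⁻ x, ∫⁻ v, g v ∂(estimateKernel noise Q fun i => (x i, c (x i)))
        ∂(Measure.pi fun _ : Fin n => PX) := by
  rw [compProd_noise_eq_bind PX noise c hc, pi_bind,
    Measure.lintegral_bind (Kernel.aemeasurable _) (hg.lintegral_kernel).aemeasurable]
  refine lintegral_congr fun x => ?_
  rw [estimateKernel, Kernel.lintegral_comp _ _ _ hg]
  rfl

/-- Integrals against the law of the estimate are controlled by the number of clean label
patterns. -/
theorem lintegral_estimate_le {n : ℕ} (PX : Measure X) [IsProbabilityMeasure PX]
    (noise : Kernel (X × Bool) Bool) [IsMarkovKernel noise] (c : X → Ω → Bool)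
    (hc : Measurable fun z : X × Ω => c z.1 z.2) (Q : Kernel (Fin n → X × Bool) Ω)
    [IsMarkovKernel Q] (ν : Measure Ω) [SFinite ν] {g : Ω × Ω → ℝ≥0∞} (hg : Measurable g)
    {B : ℝ≥0∞} (hB : ∀ v, ∫⁻ w, g (w, v) ∂ν ≤ B) {M : ℕ}
    (hM : ∀ x : Fin n → X, (patterns c x).card ≤ M) :
    ∫⁻ w, ∫⁻ x, ∫⁻ v, g (w, v) ∂(estimateKernel noise Q fun i => (x i, c (x i) w))
      ∂(Measure.pi fun _ : Fin n => PX) ∂ν ≤ M * B := by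
  set K := estimateKernel noise Q with hK
  have hz : Measurable fun a : Ω × (Fin n → X) => fun i => (a.2 i, c (a.2 i) a.1) := by
    refine measurable_pi_lambda _ fun i => ?_
    have h1 : Measurable fun a : Ω × (Fin n → X) => a.2 i := by fun_prop
    exact h1.prodMk (hc.comp (h1.prodMk measurable_fst))
  -- The inputs are fixed first, so that only finitely many label patterns remain as `w` varies.
  rw [lintegral_lintegral_swap]
  · have hx : ∀ x : Fin n → X,
        ∫⁻ w, ∫⁻ v, g (w, v) ∂(K fun i => (x i, c (x i) w)) ∂ν ≤ M * B := by
      intro x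
      calc ∫⁻ w, ∫⁻ v, g (w, v) ∂(K fun i => (x i, c (x i) w)) ∂ν
          ≤ ∫⁻ w, ∑ y ∈ patterns c x, ∫⁻ v, g (w, v) ∂(K fun i => (x i, y i)) ∂ν := by
            refine lintegral_mono fun w => ?_
            -- The pattern of `w` is one of the summands. Enlarging to the sum over all patterns
            -- decouples the law of `v` from `w`, at the price of the factor `M`.
            exact Finset.single_le_sum (f := fun y : Fin n → Bool =>
              ∫⁻ v, g (w, v) ∂(K fun i => (x i, y i))) (fun _ _ => zero_le)
              (mem_patterns c x w)
        _ = ∑ y ∈ patterns c x, ∫⁻ w, ∫⁻ v, g (w, v) ∂(K fun i => (x i, y i)) ∂ν :=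
            lintegral_finsetSum _ fun y _ => hg.lintegral_prod_right'
        _ ≤ ∑ y ∈ patterns c x, B := by
            refine Finset.sum_le_sum fun y _ => ?_
            rw [lintegral_lintegral_swap (f := fun w v => g (w, v)) hg.aemeasurable]
            exact (lintegral_mono hB).trans (by simp)
        _ = (patterns c x).card * B := by simp
        _ ≤ M * B := by gcongr; exact_mod_cast hM x
    exact (lintegral_mono hx).trans (by simp)
  · have : Measurable fun a : Ω × (Fin n → X) => ∫⁻ v, g (a.1, v) ∂((K.comap _ hz) a) :=
      Measurable.lintegral_kernel_prod_right' (f := fun b : (Ω × (Fin n → X)) × Ω =>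
        g (b.1.1, b.2)) (by fun_prop)
    exact this.aemeasurable

end Channel

/-! ### Bayes labels -/

/-- The more likely label. -/
def bayesLabel (q : Measure Bool) : Bool := open Classical in decide (q {false} < q {true})

theorem real_false_add_real_true (q : Measure Bool) [IsProbabilityMeasure q] :
    q.real {false} + q.real {true} = 1 := by
  have h := probReal_add_probReal_compl (μ := q) (measurableSet_singleton false)
  have : ({false}ᶜ : Set Bool) = {true} := by ext b; cases b <;> simp
  rwa [this] at h

theorem argmaxLabels_eq_singleton (q : Measure Bool) [IsProbabilityMeasure q]
    (h : q.real {true} ≠ q.real {false}) : argmaxLabels q = {bayesLabel q} := by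
  have hlt : ∀ a b : Bool, q {a} < q {b} ↔ q.real {a} < q.real {b} := fun a b =>
    (ENNReal.toReal_lt_toReal (measure_ne_top _ _) (measure_ne_top _ _)).symm
  have hle : ∀ a b : Bool, q {a} ≤ q {b} ↔ q.real {a} ≤ q.real {b} := fun a b =>
    (ENNReal.toReal_le_toReal (measure_ne_top _ _) (measure_ne_top _ _)).symm
  ext y
  simp only [argmaxLabels, bayesLabel, Set.mem_ofPred_eq, Set.mem_singleton_iff, hlt, hle,
    Bool.forall_bool]
  rcases lt_or_gt_of_ne h with h | h <;> cases y <;> simp [h, h.le, not_lt.2 h.le]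

theorem bayesLabel_dirac (b : Bool) : bayesLabel (Measure.dirac b) = b := by
  cases b <;> simp [bayesLabel]

theorem argmaxLabels_dirac (b : Bool) : argmaxLabels (Measure.dirac b) = {b} := by
  rw [argmaxLabels_eq_singleton, bayesLabel_dirac]
  cases b <;> simp [Measure.real]

/-- Since the two masses sum to one, `2 * q.real {true} - 1` is their difference. The margin is
therefore the gap between the labels, and a positive gap makes the maximizer unique. -/
theorem real_bayesLabel_of_margin (q : Measure Bool) [IsProbabilityMeasure q] {t : ℝ} (ht : 0 < t)
    (h : t ≤ |2 * q.real {true} - 1|) :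
    argmaxLabels q = {bayesLabel q} ∧
      ∀ b, b ≠ bayesLabel q → q.real {b} + t ≤ q.real {bayesLabel q} := by
  have hsum := real_false_add_real_true q
  have hne : q.real {true} ≠ q.real {false} := fun he => by
    rw [show 2 * q.real {true} - 1 = 0 by linarith, abs_zero] at h
    linarith
  refine ⟨argmaxLabels_eq_singleton q hne, fun b hb => ?_⟩
  have hiff : q {false} < q {true} ↔ q.real {false} < q.real {true} :=
    (ENNReal.toReal_lt_toReal (measure_ne_top _ _) (measure_ne_top _ _)).symm
  rcases lt_or_gt_of_ne hne with h1 | h1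
  · have hbl : bayesLabel q = false := by simp [bayesLabel, hiff, h1.le]
    rw [hbl] at hb ⊢
    rw [Bool.eq_true_of_not_eq_false hb]
    rw [abs_of_nonpos (by linarith)] at h
    linarith
  · have hbl : bayesLabel q = true := by simp [bayesLabel, hiff, h1]
    rw [hbl] at hb ⊢
    rw [Bool.eq_false_of_not_eq_true hb]
    rw [abs_of_nonneg (by linarith)] at h
    linarith

/-! ### The excess risk -/

section Risk

variable {𝒳 : Type*} [MeasurableSpace 𝒳] {d : ℕ} {𝒲 : Set (Fin d → ℝ)}

theorem measurable_bayesLabel (q : Kernel (𝒳 × 𝒲) Bool) :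
    Measurable fun a => bayesLabel (q a) := by
  have : MeasurableSet {a | q a {false} < q a {true}} :=
    measurableSet_lt (q.measurable_coe (measurableSet_singleton _))
      (q.measurable_coe (measurableSet_singleton _))
  refine measurable_to_bool ?_
  convert this using 1
  ext a
  simp [bayesLabel]

theorem measurable_real_bayesLabel (q : Kernel (𝒳 × 𝒲) Bool) (w v : 𝒲) :
    Measurable fun x => (q (x, w)).real {bayesLabel (q (x, v))} := by
  have h : ∀ b : Bool, Measurable fun x => (q (x, w)).real {b} := fun b =>
    ((q.measurable_coe (measurableSet_singleton b)).comp
      (measurable_prodMk_right (y := w))).ennreal_toReal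
  have hb : Measurable fun x => bayesLabel (q (x, v)) :=
    (measurable_bayesLabel q).comp measurable_prodMk_right
  have : (fun x => (q (x, w)).real {bayesLabel (q (x, v))}) = fun x =>
      if bayesLabel (q (x, v)) = true then (q (x, w)).real {true} else (q (x, w)).real {false} := by
    ext x
    cases bayesLabel (q (x, v)) <;> simp
  rw [this]
  exact Measurable.ite (hb (measurableSet_singleton true)) (h true) (h false)

theorem argmaxLabels_of_margin (q : Kernel (𝒳 × 𝒲) Bool) [IsMarkovKernel q] {t : ℝ} (ht : 0 < t)
    (hq : TsybakovMammen q t) (x : 𝒳) (w : 𝒲) :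
    argmaxLabels (q (x, w)) = {bayesLabel (q (x, w))} :=
  (real_bayesLabel_of_margin _ ht (hq x w true)).1

theorem discrepancySet_eq (q : Kernel (𝒳 × 𝒲) Bool) [IsMarkovKernel q] {t : ℝ} (ht : 0 < t)
    (hq : TsybakovMammen q t) (w v : 𝒲) :
    discrepancySet q w v = {x | bayesLabel (q (x, w)) ≠ bayesLabel (q (x, v))} := by
  ext x
  simp [discrepancySet, argmaxLabels_of_margin q ht hq]

theorem discrepancySet_eq_symmDiff (q : Kernel (𝒳 × 𝒲) Bool) [IsMarkovKernel q] {t : ℝ}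
    (ht : 0 < t) (hq : TsybakovMammen q t) (w v : 𝒲) :
    discrepancySet q w v = symmDiff {x | (x, w) ∈ {a | bayesLabel (q a) = true}}
      {x | (x, v) ∈ {a | bayesLabel (q a) = true}} := by
  rw [discrepancySet_eq q ht hq]
  ext x
  simp only [Set.mem_symmDiff, Set.mem_ofPred_eq]
  cases bayesLabel (q (x, w)) <;> cases bayesLabel (q (x, v)) <;> simp

theorem measurableSet_discrepancySet (q : Kernel (𝒳 × 𝒲) Bool) [IsMarkovKernel q] {t : ℝ}
    (ht : 0 < t) (hq : TsybakovMammen q t) (w v : 𝒲) : MeasurableSet (discrepancySet q w v) := by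
  rw [discrepancySet_eq q ht hq]
  exact (measurableSet_eq_fun ((measurable_bayesLabel q).comp (by fun_prop))
    ((measurable_bayesLabel q).comp (by fun_prop))).compl

theorem measurable_discrepancy (PX : Measure 𝒳) [IsProbabilityMeasure PX]
    (q : Kernel (𝒳 × 𝒲) Bool) [IsMarkovKernel q] {t : ℝ}
    (ht : 0 < t) (hq : TsybakovMammen q t) :
    Measurable fun z : 𝒲 × 𝒲 => PX (discrepancySet q z.1 z.2) := by
  have hS : MeasurableSet {a : (𝒲 × 𝒲) × 𝒳 |
      bayesLabel (q (a.2, a.1.1)) ≠ bayesLabel (q (a.2, a.1.2))} :=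
    (measurableSet_eq_fun ((measurable_bayesLabel q).comp (by fun_prop))
      ((measurable_bayesLabel q).comp (by fun_prop))).compl
  have := measurable_measure_prodMk_left (ν := PX) hS
  simp_rw [discrepancySet_eq q ht hq]
  exact this

theorem discrepancy_triangle (PX : Measure 𝒳) (q : Kernel (𝒳 × 𝒲) Bool) (w v w' : 𝒲) :
    PX (discrepancySet q w w') ≤ PX (discrepancySet q w v) + PX (discrepancySet q w' v) := by
  refine (measure_mono ?_).trans (measure_union_le _ _)
  intro x hx
  by_contra h
  simp only [discrepancySet, Set.mem_union, Set.mem_ofPred_eq, not_or, not_not] at h hx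
  exact hx (h.1.trans h.2.symm)

/-- The law of a sample, as a kernel. -/
def sampleKernel (PX : Measure 𝒳) [IsProbabilityMeasure PX] (q : Kernel (𝒳 × 𝒲) Bool)
    [IsMarkovKernel q] : Kernel 𝒲 (𝒳 × Bool) :=
  Kernel.const 𝒲 PX ⊗ₖ q.comap (fun a : 𝒲 × 𝒳 => (a.2, a.1)) (by fun_prop)

instance (PX : Measure 𝒳) [IsProbabilityMeasure PX] (q : Kernel (𝒳 × 𝒲) Bool)
    [IsMarkovKernel q] : IsMarkovKernel (sampleKernel PX q) := by
  unfold sampleKernel; infer_instance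

theorem sampleKernel_apply (PX : Measure 𝒳) [IsProbabilityMeasure PX] (q : Kernel (𝒳 × 𝒲) Bool)
    [IsMarkovKernel q] (w : 𝒲) : sampleKernel PX q w = sampleLaw PX q w := by
  ext s hs
  rw [sampleKernel, sampleLaw, Kernel.compProd_apply hs, Measure.compProd_apply hs]
  rfl

/-- The law of the estimate given the parameter. -/
def estimateLaw (PX : Measure 𝒳) [IsProbabilityMeasure PX] (q : Kernel (𝒳 × 𝒲) Bool)
    [IsMarkovKernel q] {n : ℕ} (Q : Kernel (Fin n → 𝒳 × Bool) 𝒲) : Kernel 𝒲 𝒲 :=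
  Q ∘ₖ piKernel fun _ : Fin n => sampleKernel PX q

instance (PX : Measure 𝒳) [IsProbabilityMeasure PX] (q : Kernel (𝒳 × 𝒲) Bool)
    [IsMarkovKernel q] {n : ℕ} (Q : Kernel (Fin n → 𝒳 × Bool) 𝒲) [IsMarkovKernel Q] :
    IsMarkovKernel (estimateLaw PX q Q) := by
  unfold estimateLaw; infer_instance

variable (PX : Measure 𝒳) [IsProbabilityMeasure PX] (q : Kernel (𝒳 × 𝒲) Bool) [IsMarkovKernel q]
  {t : ℝ}

theorem zeroOneLoss_eq (ht : 0 < t) (hq : TsybakovMammen q t) (z : 𝒳 × Bool) (v : 𝒲) :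
    zeroOneLoss q z v = if bayesLabel (q (z.1, v)) = z.2 then 0 else 1 := by
  simp [zeroOneLoss, Set.indicator, argmaxLabels_of_margin q ht hq]

theorem measurable_zeroOneLoss (ht : 0 < t) (hq : TsybakovMammen q t) :
    Measurable fun a : (𝒳 × Bool) × 𝒲 => zeroOneLoss q a.1 a.2 := by
  simp_rw [zeroOneLoss_eq q ht hq]
  refine Measurable.ite (measurableSet_eq_fun ((measurable_bayesLabel q).comp ?_) ?_)
    measurable_const measurable_const <;> fun_prop

/-- The risk of the plug-in classifier `v` under the parameter `w`. -/
def plugInRisk (w v : 𝒲) : ℝ := ∫ z, zeroOneLoss q z v ∂(sampleLaw PX q w)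

theorem measurable_plugInRisk (ht : 0 < t) (hq : TsybakovMammen q t) :
    Measurable fun a : 𝒲 × 𝒲 => plugInRisk PX q a.1 a.2 := by
  have h : Measurable fun b : (𝒲 × 𝒲) × (𝒳 × Bool) => zeroOneLoss q b.2 b.1.2 :=
    (measurable_zeroOneLoss q ht hq).comp (f := fun b : (𝒲 × 𝒲) × (𝒳 × Bool) => (b.2, b.1.2))
      (by fun_prop)
  have := h.stronglyMeasurable.integral_kernel_prod_right'
    (κ := (sampleKernel PX q).comap (Prod.fst : 𝒲 × 𝒲 → 𝒲) measurable_fst)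
  simpa only [Kernel.comap_apply, sampleKernel_apply, plugInRisk] using this.measurable

theorem plugInRisk_eq (ht : 0 < t) (hq : TsybakovMammen q t) (w v : 𝒲) :
    plugInRisk PX q w v = ∫ x, (1 - (q (x, w)).real {bayesLabel (q (x, v))}) ∂PX := by
  have hm : Measurable fun z : 𝒳 × Bool => zeroOneLoss q z v :=
    (measurable_zeroOneLoss q ht hq).comp (f := fun z : 𝒳 × Bool => (z, v)) (by fun_prop)
  have : IsProbabilityMeasure (sampleLaw PX q w) := by
    rw [← sampleKernel_apply]; infer_instance
  have hint : Integrable (fun z : 𝒳 × Bool => zeroOneLoss q z v) (sampleLaw PX q w) :=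
    Integrable.of_bound hm.aestronglyMeasurable 1 (Filter.Eventually.of_forall fun z => by
      rw [zeroOneLoss_eq q ht hq]; split_ifs <;> simp)
  rw [plugInRisk, sampleLaw, Measure.integral_compProd hint]
  refine integral_congr_ae (Filter.Eventually.of_forall fun x => ?_)
  simp only [Kernel.comap_apply]
  have : (fun y => zeroOneLoss q (x, y) v) =
      ({bayesLabel (q (x, v))}ᶜ : Set Bool).indicator (fun _ => (1 : ℝ)) := by
    ext y
    rw [zeroOneLoss_eq q ht hq]
    simp only [Set.indicator, Set.mem_compl_iff, Set.mem_singleton_iff]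
    by_cases h : bayesLabel (q (x, v)) = y
    · simp [h]
    · simp [h, Ne.symm h]
  rw [this, integral_indicator_const _ (measurableSet_singleton _).compl]
  rw [probReal_compl_eq_one_sub (measurableSet_singleton _), smul_eq_mul, mul_one]

theorem plugInRisk_mem (ht : 0 < t) (hq : TsybakovMammen q t) (w v : 𝒲) :
    ‖plugInRisk PX q w v‖ ≤ 1 := by
  rw [plugInRisk_eq PX q ht hq]
  refine (norm_integral_le_of_norm_le_const (C := 1)
    (Filter.Eventually.of_forall fun x => ?_)).trans (by simp)
  rw [Real.norm_eq_abs, abs_le]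
  have h0 : 0 ≤ (q (x, w)).real {bayesLabel (q (x, v))} := measureReal_nonneg
  have h1 : (q (x, w)).real {bayesLabel (q (x, v))} ≤ 1 := measureReal_le_one
  constructor <;> linarith

/-- The excess risk of a plug-in classifier is at least the margin times the discrepancy. -/
theorem plugInRisk_self_add_le (ht : 0 < t) (hq : TsybakovMammen q t) (w v : 𝒲) :
    plugInRisk PX q w w + t * PX.real (discrepancySet q w v) ≤ plugInRisk PX q w v := by
  have hD := measurableSet_discrepancySet q ht hq w v
  have hint : ∀ v, Integrable (fun x => 1 - (q (x, w)).real {bayesLabel (q (x, v))}) PX := fun v =>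
    Integrable.of_bound (measurable_const.sub (measurable_real_bayesLabel q w v)).aestronglyMeasurable
      1 (Filter.Eventually.of_forall fun x => by
        rw [Real.norm_eq_abs, abs_le]
        have h0 : 0 ≤ (q (x, w)).real {bayesLabel (q (x, v))} := measureReal_nonneg
        have h1 : (q (x, w)).real {bayesLabel (q (x, v))} ≤ 1 := measureReal_le_one
        constructor <;> linarith)
  have hind : Integrable ((discrepancySet q w v).indicator fun _ => t) PX :=
    (integrable_const t).indicator hD
  have he : t * PX.real (discrepancySet q w v) =
      ∫ x, (discrepancySet q w v).indicator (fun _ => t) x ∂PX := by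
    rw [integral_indicator_const _ hD, smul_eq_mul, mul_comm]
  rw [plugInRisk_eq PX q ht hq, plugInRisk_eq PX q ht hq, he, ← integral_add (hint w) hind]
  refine integral_mono ((hint w).add hind) (hint v) fun x => ?_
  by_cases hx : x ∈ discrepancySet q w v
  · rw [Set.indicator_of_mem hx]
    rw [discrepancySet_eq q ht hq] at hx
    have := (real_bayesLabel_of_margin _ ht (hq x w true)).2 _ (Ne.symm hx)
    linarith
  · rw [Set.indicator_of_notMem hx]
    rw [discrepancySet_eq q ht hq, Set.mem_ofPred_eq, not_not] at hx
    rw [hx, add_zero]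

theorem bayesRisk_eq (ht : 0 < t) (hq : TsybakovMammen q t) (PW : Measure 𝒲) {n : ℕ}
    (Q : Kernel (Fin n → 𝒳 × Bool) 𝒲) [IsMarkovKernel Q] :
    bayesRisk PX PW q Q = ∫ w, ∫ v, plugInRisk PX q w v ∂(estimateLaw PX q Q w) ∂PW := by
  unfold bayesRisk
  refine integral_congr_ae (Filter.Eventually.of_forall fun w => ?_)
  have hint : Integrable (fun v => plugInRisk PX q w v) (estimateLaw PX q Q w) :=
    Integrable.of_bound ((measurable_plugInRisk PX q ht hq).comp
      measurable_prodMk_left).aestronglyMeasurable 1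
      (Filter.Eventually.of_forall fun v => plugInRisk_mem PX q ht hq w v)
  simp only [estimateLaw] at hint ⊢
  rw [Kernel.integral_comp hint, piKernel_apply]
  simp_rw [sampleKernel_apply]
  rfl

/-- The excess Bayes risk is at least the margin times the expected discrepancy. -/
theorem discrepancy_le_excessBayesRisk (ht : 0 < t) (hq : TsybakovMammen q t) (PW : Measure 𝒲)
    [IsProbabilityMeasure PW] {n : ℕ} (Q : Kernel (Fin n → 𝒳 × Bool) 𝒲) [IsMarkovKernel Q] :
    t * (∫⁻ w, ∫⁻ v, PX (discrepancySet q w v) ∂(estimateLaw PX q Q w) ∂PW).toReal ≤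
      excessBayesRisk PX PW q Q := by
  set κ := estimateLaw PX q Q with hκ
  have hL := measurable_plugInRisk PX q ht hq
  have hρ := measurable_discrepancy PX q ht hq
  have hρr : Measurable fun a : 𝒲 × 𝒲 => PX.real (discrepancySet q a.1 a.2) := hρ.ennreal_toReal
  have hLint : ∀ w, Integrable (fun v => plugInRisk PX q w v) (κ w) := fun w =>
    Integrable.of_bound (hL.comp measurable_prodMk_left).aestronglyMeasurable 1
      (Filter.Eventually.of_forall fun v => plugInRisk_mem PX q ht hq w v)
  have hρint : ∀ w, Integrable (fun v => PX.real (discrepancySet q w v)) (κ w) := fun w =>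
    Integrable.of_bound (hρr.comp measurable_prodMk_left).aestronglyMeasurable 1
      (Filter.Eventually.of_forall fun v => by
        rw [Real.norm_of_nonneg measureReal_nonneg]; exact measureReal_le_one)
  have hLoint : Integrable (fun w => plugInRisk PX q w w) PW :=
    Integrable.of_bound (hL.comp (measurable_id.prodMk measurable_id)).aestronglyMeasurable 1
      (Filter.Eventually.of_forall fun w => plugInRisk_mem PX q ht hq w w)
  have hLκ : Integrable (fun w => ∫ v, plugInRisk PX q w v ∂(κ w)) PW :=
    Integrable.of_bound (hL.stronglyMeasurable.integral_kernel_prod_right').aestronglyMeasurable 1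
      (Filter.Eventually.of_forall fun w =>
        (norm_integral_le_of_norm_le_const (Filter.Eventually.of_forall fun v =>
          plugInRisk_mem PX q ht hq w v)).trans (by simp))
  have hρκ : Integrable (fun w => ∫ v, PX.real (discrepancySet q w v) ∂(κ w)) PW :=
    Integrable.of_bound (hρr.stronglyMeasurable.integral_kernel_prod_right').aestronglyMeasurable 1
      (Filter.Eventually.of_forall fun w =>
        (norm_integral_le_of_norm_le_const (C := 1) (Filter.Eventually.of_forall fun v => by
          rw [Real.norm_of_nonneg measureReal_nonneg]; exact measureReal_le_one)).trans (by simp))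
  have hconv : (∫⁻ w, ∫⁻ v, PX (discrepancySet q w v) ∂(κ w) ∂PW).toReal =
      ∫ w, ∫ v, PX.real (discrepancySet q w v) ∂(κ w) ∂PW := by
    have h1 : ∀ w, ∫⁻ v, PX (discrepancySet q w v) ∂(κ w) =
        ENNReal.ofReal (∫ v, PX.real (discrepancySet q w v) ∂(κ w)) := fun w => by
      rw [ofReal_integral_eq_lintegral_ofReal (hρint w)
        (Filter.Eventually.of_forall fun v => measureReal_nonneg)]
      exact lintegral_congr fun v => (ofReal_measureReal).symm
    simp_rw [h1]
    rw [← ofReal_integral_eq_lintegral_ofReal hρκ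
      (Filter.Eventually.of_forall fun w => integral_nonneg fun v => measureReal_nonneg),
      ENNReal.toReal_ofReal (integral_nonneg fun w => integral_nonneg fun v => measureReal_nonneg)]
  have horacle : oracleRisk PX PW q = ∫ w, plugInRisk PX q w w ∂PW := rfl
  rw [hconv, excessBayesRisk, bayesRisk_eq PX q ht hq, horacle, le_sub_iff_add_le,
    ← integral_const_mul, ← integral_add (hρκ.const_mul t) hLoint]
  refine integral_mono ((hρκ.const_mul t).add hLoint) hLκ fun w => ?_
  have hc : plugInRisk PX q w w = ∫ _, plugInRisk PX q w w ∂(κ w) := by simp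
  rw [hc, ← integral_const_mul, ← integral_add ((hρint w).const_mul t) (integrable_const _)]
  refine integral_mono (((hρint w).const_mul t).add (integrable_const _)) (hLint w) fun v => ?_
  have := plugInRisk_self_add_le PX q ht hq w v
  linarith

end Risk

/-! ### Entropy bounds -/

section Entropy

/-- If the negative part has infinite integral, the difference is `⊥` in `EReal`, even for `∞ - ∞`.
Otherwise the integrable majorant makes `F` integrable and the difference is an ordinary integral.
-/
theorem posPart_sub_negPart_le {Ω : Type*} [MeasurableSpace Ω] {ν : Measure Ω} {F R : Ω → ℝ}
    (hF : Measurable F) (hR : Integrable R ν) (hFR : ∀ᵐ w ∂ν, F w ≤ R w) :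
    ((∫⁻ w, ENNReal.ofReal (F w) ∂ν : ℝ≥0∞) : EReal) -
      ((∫⁻ w, ENNReal.ofReal (-F w) ∂ν : ℝ≥0∞) : EReal) ≤ ((∫ w, R w ∂ν : ℝ) : EReal) := by
  by_cases hneg : ∫⁻ w, ENNReal.ofReal (-F w) ∂ν = ∞
  · rw [hneg, EReal.coe_ennreal_top, EReal.sub_top]; exact bot_le
  have hpos : ∫⁻ w, ENNReal.ofReal (F w) ∂ν ≠ ∞ := by
    refine ((lintegral_mono_ae ?_).trans_lt hR.lintegral_lt_top).ne
    filter_upwards [hFR] with w hw using ENNReal.ofReal_le_ofReal hw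
  have hint : Integrable F ν := by
    refine ⟨hF.aestronglyMeasurable, ?_⟩
    rw [hasFiniteIntegral_iff_norm]
    have : ∀ w, ENNReal.ofReal ‖F w‖ = ENNReal.ofReal (F w) + ENNReal.ofReal (-F w) := fun w => by
      rcases le_total 0 (F w) with h | h
      · rw [Real.norm_of_nonneg h, ENNReal.ofReal_of_nonpos (neg_nonpos.2 h), add_zero]
      · rw [Real.norm_of_nonpos h, ENNReal.ofReal_of_nonpos h, zero_add]
    simp_rw [this]
    rw [lintegral_add_left hF.ennreal_ofReal]
    exact ENNReal.add_lt_top.2 ⟨lt_top_iff_ne_top.2 hpos, lt_top_iff_ne_top.2 hneg⟩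
  have he : ((∫⁻ w, ENNReal.ofReal (F w) ∂ν : ℝ≥0∞) : EReal) -
      ((∫⁻ w, ENNReal.ofReal (-F w) ∂ν : ℝ≥0∞) : EReal) = ((∫ w, F w ∂ν : ℝ) : EReal) := by
    rw [integral_eq_lintegral_pos_part_sub_lintegral_neg_part hint, EReal.coe_sub,
      EReal.coe_ennreal_toReal hpos, EReal.coe_ennreal_toReal hneg]
  rw [he]
  exact_mod_cast integral_mono_ae hint hR hFR

/-- The pointwise form of the Gibbs inequality. -/
theorem negMulLog_le_exp_div {φ c r : ℝ} (hφ : 0 < φ) (hc : 0 < c) :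
    Real.negMulLog φ ≤ Real.exp (-r) / c - φ + φ * Real.log c + φ * r := by
  -- This is `log u ≤ u - 1` at `u = exp (-r) / (c φ)`, to be multiplied by `φ`.
  have h := Real.log_le_sub_one_of_pos (x := Real.exp (-r) / c / φ) (by positivity)
  rw [Real.log_div (by positivity) hφ.ne', Real.log_div (by positivity) hc.ne', Real.log_exp] at h
  have h2 := mul_le_mul_of_nonneg_left h hφ.le
  have h3 : φ * (Real.exp (-r) / c / φ - 1) = Real.exp (-r) / c - φ := by field_simp
  rw [h3] at h2
  rw [Real.negMulLog]
  linarith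

/-- A Shannon lower bound: the entropy of a density `φ` is controlled by the expected distortion
and the exponential integral of the distortion. -/
theorem entropy_le_log_add {Ω : Type*} [MeasurableSpace Ω] (ν : Measure Ω)
    (φ : Ω → ℝ) (hφ : Measurable φ) (hφ0 : ∀ w, 0 ≤ φ w) (hφint : Integrable φ ν)
    (hφ1 : ∫ w, φ w ∂ν = 1) (κ : Kernel Ω Ω) [IsMarkovKernel κ] (ρ : Ω × Ω → ℝ)
    (hρ : Measurable ρ) (hρ0 : ∀ z, 0 ≤ ρ z) (hρ1 : ∀ z, ρ z ≤ 1) {s c : ℝ} (hs : 0 < s)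
    (hc : 0 < c)
    (hJ : ∫⁻ w in {w | φ w ≠ 0}, ∫⁻ v, ENNReal.ofReal (Real.exp (-s * ρ (w, v))) ∂(κ w) ∂ν ≤
      ENNReal.ofReal c) :
    ((∫⁻ w, ENNReal.ofReal (Real.negMulLog (φ w)) ∂ν : ℝ≥0∞) : EReal) -
      ((∫⁻ w, ENNReal.ofReal (-Real.negMulLog (φ w)) ∂ν : ℝ≥0∞) : EReal) ≤
      ((Real.log c + s * ∫ w, φ w * ∫ v, ρ (w, v) ∂(κ w) ∂ν : ℝ) : EReal) := by
  set S : Set Ω := {w | φ w ≠ 0} with hS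
  have hSm : MeasurableSet S := hφ (measurableSet_singleton 0).compl
  set E : Ω → ℝ := fun w => ∫ v, Real.exp (-s * ρ (w, v)) ∂(κ w) with hE
  set D : Ω → ℝ := fun w => ∫ v, ρ (w, v) ∂(κ w) with hD
  have hem : Measurable fun z => Real.exp (-s * ρ z) := by fun_prop
  have hρint : ∀ w, Integrable (fun v => ρ (w, v)) (κ w) := fun w =>
    Integrable.of_bound (hρ.comp measurable_prodMk_left).aestronglyMeasurable 1
      (Filter.Eventually.of_forall fun v => by rw [Real.norm_of_nonneg (hρ0 _)]; exact hρ1 _)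
  have heint : ∀ w, Integrable (fun v => Real.exp (-s * ρ (w, v))) (κ w) := fun w =>
    Integrable.of_bound (hem.comp measurable_prodMk_left).aestronglyMeasurable 1
      (Filter.Eventually.of_forall fun v => by
        rw [Real.norm_of_nonneg (Real.exp_nonneg _), Real.exp_le_one_iff]
        have := mul_nonneg hs.le (hρ0 (w, v))
        linarith)
  have hEm : Measurable E := (hem.stronglyMeasurable.integral_kernel_prod_right').measurable
  have hDm : Measurable D := (hρ.stronglyMeasurable.integral_kernel_prod_right').measurable
  have hE0 : ∀ w, 0 ≤ E w := fun w => integral_nonneg fun v => Real.exp_nonneg _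
  have hD0 : ∀ w, 0 ≤ D w := fun w => integral_nonneg fun v => hρ0 _
  have hD1 : ∀ w, D w ≤ 1 := fun w =>
    (integral_mono (hρint w) (integrable_const 1) fun v => hρ1 _).trans (by simp)
  have hEof : ∀ w, ENNReal.ofReal (E w) =
      ∫⁻ v, ENNReal.ofReal (Real.exp (-s * ρ (w, v))) ∂(κ w) := fun w =>
    ofReal_integral_eq_lintegral_ofReal (heint w)
      (Filter.Eventually.of_forall fun v => Real.exp_nonneg _)
  simp_rw [← hEof] at hJ
  have hEint : IntegrableOn E S ν := by
    refine ⟨hEm.aestronglyMeasurable, ?_⟩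
    rw [hasFiniteIntegral_iff_ofReal (Filter.Eventually.of_forall hE0)]
    exact hJ.trans_lt ENNReal.ofReal_lt_top
  have hEle : ∫ w in S, E w ∂ν ≤ c := by
    rw [integral_eq_lintegral_of_nonneg_ae (Filter.Eventually.of_forall hE0)
      hEm.aestronglyMeasurable]
    exact ENNReal.toReal_le_of_le_ofReal hc.le hJ
  have hφD : Integrable (fun w => φ w * D w) ν := by
    refine hφint.mono (hφ.mul hDm).aestronglyMeasurable (Filter.Eventually.of_forall fun w => ?_)
    rw [Real.norm_of_nonneg (mul_nonneg (hφ0 w) (hD0 w)), Real.norm_of_nonneg (hφ0 w)]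
    exact mul_le_of_le_one_right (hφ0 w) (hD1 w)
  -- The majorant is the pointwise Gibbs bound with `r = s ρ(w, v)`, averaged over `v`. The
  -- indicator is harmless because `negMulLog 0 = 0`, and needed because the exponential integral is
  -- controlled only where the density is nonzero.
  have h1 : Integrable (fun w => S.indicator E w / c) ν :=
    ((integrable_indicator_iff hSm).2 hEint).div_const c
  have h2 : Integrable (fun w => φ w * (Real.log c - 1)) ν := hφint.mul_const _
  have h3 : Integrable (fun w => s * (φ w * D w)) ν := hφD.const_mul s
  have hR := (h1.add h2).add h3
  refine (posPart_sub_negPart_le (Real.continuous_negMulLog.measurable.comp hφ) hR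
    (Filter.Eventually.of_forall fun w => ?_)).trans ?_
  · simp only [Function.comp_apply, Pi.add_apply]
    by_cases hw : φ w = 0
    · have : w ∉ S := fun h => h hw
      simp [hw, Set.indicator_of_notMem this]
    · have hmem : w ∈ S := hw
      have hpos : 0 < φ w := lt_of_le_of_ne (hφ0 w) (Ne.symm hw)
      rw [Set.indicator_of_mem hmem]
      have hc0 : Real.negMulLog (φ w) = ∫ _, Real.negMulLog (φ w) ∂(κ w) := by simp
      have hi1 : Integrable (fun v => Real.exp (-s * ρ (w, v)) / c + φ w * (Real.log c - 1)) (κ w) :=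
        ((heint w).div_const c).add (integrable_const _)
      have hi2 : Integrable (fun v => s * φ w * ρ (w, v)) (κ w) := (hρint w).const_mul _
      calc Real.negMulLog (φ w) = ∫ _, Real.negMulLog (φ w) ∂(κ w) := hc0
        _ ≤ ∫ v, (Real.exp (-s * ρ (w, v)) / c + φ w * (Real.log c - 1)) + s * φ w * ρ (w, v)
            ∂(κ w) := by
          refine integral_mono (integrable_const _) (hi1.add hi2) fun v => ?_
          have := negMulLog_le_exp_div (r := s * ρ (w, v)) hpos hc
          rw [← neg_mul] at this
          simp only
          linarith
        _ = E w / c + φ w * (Real.log c - 1) + s * (φ w * D w) := by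
          rw [integral_add hi1 hi2, integral_add ((heint w).div_const c) (integrable_const _),
            integral_div, integral_const_mul (s * φ w)]
          simp [hE, hD, mul_assoc]
  · rw [EReal.coe_le_coe_iff]
    have e1 : ∫ w, ((fun w => S.indicator E w / c) + (fun w => φ w * (Real.log c - 1)) +
        fun w => s * (φ w * D w)) w ∂ν =
        (∫ w in S, E w ∂ν) / c + (Real.log c - 1) + s * ∫ w, φ w * D w ∂ν := by
      rw [integral_add' (h1.add h2) h3, integral_add' h1 h2, integral_div,
        integral_indicator hSm, integral_mul_const, hφ1, one_mul, integral_const_mul]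
    rw [e1]
    -- This term is absorbed by the `-1` in `log c - 1`.
    have : (∫ w in S, E w ∂ν) / c ≤ 1 := (div_le_one hc).2 hEle
    linarith

/-- Optimizing the Shannon lower bound over the slope. -/
theorem entropy_power_le {h : EReal} {d : ℕ} (hd : 0 < d) {M mu D : ℝ} (hM : 0 < M) (hmu : 0 < mu)
    (hD : 0 ≤ D)
    (H : ∀ s : ℝ, 0 < s →
      h ≤ ((Real.log (M * (d.factorial * (2 / mu / s) ^ d)) + s * D : ℝ) : EReal)) :
    ((mu / (2 * Real.exp 1) * M ^ (-(1 / (d : ℝ))) : ℝ) : EReal) *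
      ((EReal.exp (h / ((d : ℝ) : EReal)) : ℝ≥0∞) : EReal) ≤ ((D : ℝ) : EReal) := by
  have hd' : (0 : ℝ) < d := by exact_mod_cast hd
  induction h with
  | bot =>
    rw [EReal.bot_div_of_pos_ne_top (by exact_mod_cast hd') (EReal.coe_ne_top _)]
    simp only [EReal.exp_bot, EReal.coe_ennreal_zero, mul_zero]
    exact_mod_cast hD
  | top => exact absurd (H 1 one_pos) (not_le.2 (EReal.coe_lt_top _))
  | coe r =>
    rw [← EReal.coe_div, EReal.exp_coe, EReal.coe_ennreal_ofReal, max_eq_left (Real.exp_nonneg _),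
      ← EReal.coe_mul, EReal.coe_le_coe_iff]
    -- The optimal slope is `d / D`, but `D` may vanish; working with any `D' > D` and `s = d / D'`
    -- avoids this.
    refine le_of_forall_gt_imp_ge_of_dense fun D' hD' => ?_
    have hD'0 : 0 < D' := hD.trans_lt hD'
    have h1 := EReal.coe_le_coe_iff.1 (H (d / D') (by positivity))
    have hfac : (d.factorial : ℝ) ≤ (d : ℝ) ^ d := by exact_mod_cast Nat.factorial_le_pow d
    have h2 : Real.log (M * (d.factorial * (2 / mu / (d / D')) ^ d)) ≤
        Real.log M + d * Real.log (2 * D' / mu) := by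
      rw [Real.log_mul hM.ne' (by positivity)]
      gcongr
      rw [← Real.log_pow]
      refine Real.log_le_log (by positivity) ?_
      calc (d.factorial : ℝ) * (2 / mu / (d / D')) ^ d
          ≤ (d : ℝ) ^ d * (2 / mu / (d / D')) ^ d := by gcongr
        _ = (2 * D' / mu) ^ d := by rw [← mul_pow]; congr 1; field_simp
    have h3 : (d / D') * D ≤ d := by
      rw [div_mul_eq_mul_div, div_le_iff₀ hD'0]
      exact mul_le_mul_of_nonneg_left hD'.le hd'.le
    have h4 : r / d ≤ Real.log M * (1 / d) + Real.log (2 * D' / mu) + 1 := by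
      rw [div_le_iff₀ hd']
      have : (Real.log M * (1 / d) + Real.log (2 * D' / mu) + 1) * d =
          Real.log M + d * Real.log (2 * D' / mu) + d := by field_simp
      linarith
    have h5 : Real.exp (r / d) ≤ M ^ (1 / (d : ℝ)) * (2 * D' / mu) * Real.exp 1 := by
      refine (Real.exp_le_exp.2 h4).trans_eq ?_
      rw [Real.exp_add, Real.exp_add, Real.exp_log (by positivity), ← Real.rpow_def_of_pos hM]
    calc mu / (2 * Real.exp 1) * M ^ (-(1 / (d : ℝ))) * Real.exp (r / d)
        ≤ mu / (2 * Real.exp 1) * M ^ (-(1 / (d : ℝ))) *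
          (M ^ (1 / (d : ℝ)) * (2 * D' / mu) * Real.exp 1) := by gcongr
      _ = (M ^ (-(1 / (d : ℝ))) * M ^ (1 / (d : ℝ))) * D' := by field_simp
      _ = D' := by rw [← Real.rpow_add hM]; simp

end Entropy

/-! ### The noisy model -/

section NoisyModel

variable {𝒳 : Type*} [MeasurableSpace 𝒳] {d : ℕ} {𝒲 : Set (Fin d → ℝ)}

theorem eq_dirac_bayesLabel (q : Measure Bool) [IsProbabilityMeasure q]
    (h : ∀ y : Bool, q {y} = 0 ∨ q {y} = 1) : q = Measure.dirac (bayesLabel q) := by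
  have hsum := real_false_add_real_true q
  have hext : ∀ b, q {b} = 1 → q = Measure.dirac b := fun b hb => by
    have hae : ∀ᵐ y ∂q, y = b :=
      (prob_compl_eq_zero_iff (μ := q) (measurableSet_singleton b)).2 hb
    have h : q.map id = q.map fun _ => b := Measure.map_congr (μ := q) (f := (id : Bool → Bool)) (g := fun _ => b) hae
    rwa [Measure.map_id, Measure.map_const, measure_univ, one_smul] at h
  rcases h true with h1 | h1
  · have h2 : q {false} = 1 := by
      rcases h false with h2 | h2
      · simp [Measure.real, h1, h2] at hsum
      · exact h2
    rw [hext false h2, bayesLabel_dirac]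
  · rw [hext true h1, bayesLabel_dirac]

instance (p : Kernel (𝒳 × 𝒲) Bool) [IsMarkovKernel p] (noise : Kernel (𝒳 × Bool) Bool)
    [IsMarkovKernel noise] : IsMarkovKernel (noisyLabels p noise) := by
  unfold noisyLabels; infer_instance

/-- In a realizable model the noisy label is the noise applied to the clean label. -/
theorem noisyLabels_apply (p : Kernel (𝒳 × 𝒲) Bool) [IsMarkovKernel p] (hp : IsRealizable p)
    (noise : Kernel (𝒳 × Bool) Bool) [IsMarkovKernel noise] (x : 𝒳) (w : 𝒲) :
    noisyLabels p noise (x, w) = noise (x, bayesLabel (p (x, w))) := by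
  ext s hs
  rw [noisyLabels, Kernel.snd_apply' _ _ hs, Kernel.compProd_apply (measurable_snd hs)]
  have hdirac : p (x, w) = Measure.dirac (bayesLabel (p (x, w))) :=
    eq_dirac_bayesLabel _ (hp x w)
  rw [hdirac, lintegral_dirac, bayesLabel_dirac]
  rfl

theorem positiveRegion_eq (p : Kernel (𝒳 × 𝒲) Bool) [IsMarkovKernel p] (hp : IsRealizable p)
    (w : 𝒲) : positiveRegion p w = {x | bayesLabel (p (x, w)) = true} := by
  ext x
  have hdirac : p (x, w) = Measure.dirac (bayesLabel (p (x, w))) :=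
    eq_dirac_bayesLabel _ (hp x w)
  simp only [positiveRegion, Set.mem_ofPred_eq]
  rw [hdirac, argmaxLabels_dirac, bayesLabel_dirac]
  simp

theorem card_le_of_isShattered {p : Kernel (𝒳 × 𝒲) Bool} {D : ℕ} (h : vcDimension p = D)
    (s : Finset 𝒳) (hs : IsShattered p s) : s.card ≤ D := by
  have : (s.card : ℕ∞) ≤ vcDimension p :=
    le_iSup₂ (f := fun (s : Finset 𝒳) (_ : IsShattered p s) => (s.card : ℕ∞)) s hs
  rw [h] at this
  exact_mod_cast this

theorem sampleLaw_noisyLabels (p : Kernel (𝒳 × 𝒲) Bool) [IsMarkovKernel p] (hp : IsRealizable p)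
    (noise : Kernel (𝒳 × Bool) Bool) [IsMarkovKernel noise] (PX : Measure 𝒳) (w : 𝒲)
    (hc : Measurable fun x => (x, bayesLabel (p (x, w)))) :
    sampleLaw PX (noisyLabels p noise) w =
      PX ⊗ₘ noise.comap (fun x => (x, bayesLabel (p (x, w)))) hc := by
  unfold sampleLaw
  congr 1
  ext x : 1
  rw [Kernel.comap_apply, Kernel.comap_apply, noisyLabels_apply p hp]

/-- Integrals against the law of the estimate are controlled by the number of label patterns. -/
theorem lintegral_estimateLaw_le (p : Kernel (𝒳 × 𝒲) Bool) [IsMarkovKernel p]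
    (hp : IsRealizable p) {D : ℕ} (hD : vcDimension p = D)
    (noise : Kernel (𝒳 × Bool) Bool) [IsMarkovKernel noise] (PX : Measure 𝒳)
    [IsProbabilityMeasure PX] {n : ℕ} (Q : Kernel (Fin n → 𝒳 × Bool) 𝒲) [IsMarkovKernel Q]
    (ν : Measure 𝒲) [SFinite ν] {g : 𝒲 × 𝒲 → ℝ≥0∞} (hg : Measurable g) {B : ℝ≥0∞}
    (hB : ∀ v, ∫⁻ w, g (w, v) ∂ν ≤ B) :
    ∫⁻ w, ∫⁻ v, g (w, v) ∂(estimateLaw PX (noisyLabels p noise) Q w) ∂ν ≤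
      ((∑ k ∈ Finset.Iic D, n.choose k : ℕ) : ℝ≥0∞) * B := by
  have hb := measurable_bayesLabel p
  refine (le_of_eq ?_).trans (lintegral_estimate_le PX noise (fun x w => bayesLabel (p (x, w))) hb
    Q ν hg hB (M := ∑ k ∈ Finset.Iic D, n.choose k) fun x => ?_)
  · refine lintegral_congr fun w => ?_
    have hbw : Measurable fun x => bayesLabel (p (x, w)) := hb.comp measurable_prodMk_right
    have hgw : Measurable fun v => g (w, v) := hg.comp measurable_prodMk_left
    rw [estimateLaw, Kernel.lintegral_comp _ _ _ hgw, piKernel_apply]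
    simp_rw [sampleKernel_apply, sampleLaw_noisyLabels p hp noise PX w (by fun_prop)]
    exact lintegral_pi_compProd_noise PX noise _ hbw Q hgw
  · refine card_patterns_le _ (fun s hs => card_le_of_isShattered hD s fun t ht => ?_) x
    obtain ⟨w, hw⟩ := hs t ht
    exact ⟨w, by rw [positiveRegion_eq p hp]; exact hw⟩

end NoisyModel

/-! ### Sensitivity and the exponential integral -/

section Sensitivity

variable {𝒳 : Type*} [MeasurableSpace 𝒳] {d : ℕ} {𝒲 : Set (Fin d → ℝ)}

/-- Sensitivity in expectation implies sensitivity for almost all pairs of parameters. -/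
theorem ae_sensitive (PX : Measure 𝒳) [IsProbabilityMeasure PX]
    (PW : Measure 𝒲) [IsProbabilityMeasure PW] (hPW : PW.map (Subtype.val : 𝒲 → Fin d → ℝ) ≪ volume)
    (q : Kernel (𝒳 × 𝒲) Bool) [IsMarkovKernel q] {t : ℝ} (ht : 0 < t) (hq : TsybakovMammen q t)
    {mu : ℝ} (hsens : SensitiveInExpectation PX PW q mu) :
    ∀ᵐ z ∂(PW.prod PW), ENNReal.ofReal mu * edist (z.1 : Fin d → ℝ) (z.2 : Fin d → ℝ) ≤
      PX (discrepancySet q z.1 z.2) := by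
  have hnorm : Measurable fun z : 𝒲 × 𝒲 => edist (z.1 : Fin d → ℝ) (z.2 : Fin d → ℝ) :=
    (measurable_subtype_coe.comp measurable_fst).edist (measurable_subtype_coe.comp measurable_snd)
  refine ae_le_of_forall_kernel PW (fun z => PX (discrepancySet q z.1 z.2))
    (fun z => ENNReal.ofReal mu * edist (z.1 : Fin d → ℝ) (z.2 : Fin d → ℝ))
    (measurable_discrepancy PX q ht hq) (hnorm.const_mul _) (fun z => prob_le_one) ?_ ?_
  · intro ε hε
    obtain ⟨R, hR, hle, hpos⟩ := exists_close_pairs PX PW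
      ((measurable_bayesLabel q) (measurableSet_singleton true)) hε
    refine ⟨R, hR, fun w v hwv => ?_, hpos⟩
    rw [discrepancySet_eq_symmDiff q ht hq]
    exact hle w v hwv
  · intro V hV hac
    -- Only laws absolutely continuous with respect to the prior are tested; they are
    -- Lebesgue-continuous because the prior is.
    have := hsens V hV fun w => ((hac w).map measurable_subtype_coe).trans hPW
    refine le_trans (le_of_eq ?_) this
    simp_rw [← edist_eq_enorm_sub]
    rw [← lintegral_const_mul _ (hnorm.lintegral_kernel_prod_right' (κ := V))]
    exact lintegral_congr fun w => lintegral_const_mul _ (hnorm.comp measurable_prodMk_left)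

/-- Almost sure sensitivity bounds the volume of discrepancy balls. -/
theorem volume_discrepancy_ball_le (h𝒲 : MeasurableSet 𝒲) (PX : Measure 𝒳)
    (PW : Measure 𝒲) [SFinite PW] (q : Kernel (𝒳 × 𝒲) Bool) {mu : ℝ} (hmu : 0 < mu)
    (hae : ∀ᵐ z ∂(PW.prod PW), ENNReal.ofReal mu * edist (z.1 : Fin d → ℝ) (z.2 : Fin d → ℝ) ≤
      PX (discrepancySet q z.1 z.2))
    (ν : Measure 𝒲) [SFinite ν] (hν : ν ≤ volume.comap Subtype.val) (hac : ν ≪ PW) (v : 𝒲)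
    {r : ℝ} (hr : 0 < r) (hm : MeasurableSet {w | PX (discrepancySet q w v) ≤ ENNReal.ofReal r}) :
    ν {w | PX (discrepancySet q w v) ≤ ENNReal.ofReal r} ≤ ENNReal.ofReal (2 / mu * r) ^ d := by
  set T : Set 𝒲 := {w | PX (discrepancySet q w v) ≤ ENNReal.ofReal r} with hT
  set ν' : Measure (Fin d → ℝ) := (ν.restrict T).map Subtype.val with hν'
  have hν'le : ν' ≤ volume := by
    refine Measure.le_iff.2 fun S hS => ?_
    rw [hν', Measure.map_apply measurable_subtype_coe hS]
    calc (ν.restrict T) (Subtype.val ⁻¹' S) ≤ ν (Subtype.val ⁻¹' S) := Measure.restrict_le_self _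
      _ ≤ (volume.comap Subtype.val) (Subtype.val ⁻¹' S) := hν _
      _ = volume ((Subtype.val : 𝒲 → Fin d → ℝ) '' (Subtype.val ⁻¹' S)) :=
        comap_subtype_coe_apply h𝒲 _ _
      _ ≤ volume S := measure_mono (Set.image_preimage_subset _ _)
  have huniv : ν T = ν' Set.univ := by
    rw [hν', Measure.map_apply measurable_subtype_coe MeasurableSet.univ]
    simp
  rw [huniv]
  refine measure_univ_le_pow_of_ae_edist_le hν'le _ ?_
  have hmap : ν'.prod ν' = ((ν.restrict T).prod (ν.restrict T)).map
      (Prod.map (Subtype.val : 𝒲 → Fin d → ℝ) (Subtype.val : 𝒲 → Fin d → ℝ)) :=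
    Measure.map_prod_map _ _ measurable_subtype_coe measurable_subtype_coe
  rw [hmap, ae_map_iff (measurable_subtype_coe.prodMap measurable_subtype_coe).aemeasurable
    (measurableSet_le (by fun_prop) measurable_const)]
  have hacT : (ν.restrict T).prod (ν.restrict T) ≪ PW.prod PW := by
    have := (Measure.absolutelyContinuous_of_le (Measure.restrict_le_self (s := T) (μ := ν))).trans hac
    exact this.prod this
  have hmem : ∀ᵐ z ∂((ν.restrict T).prod (ν.restrict T)), z ∈ T ×ˢ T := by
    rw [Measure.prod_restrict]
    exact ae_restrict_mem (hm.prod hm)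
  filter_upwards [hacT.ae_le hae, hmem] with z hz hzT
  have h1 : ENNReal.ofReal mu * edist (z.1 : Fin d → ℝ) (z.2 : Fin d → ℝ) ≤
      ENNReal.ofReal (2 * r) := by
    -- Sensitivity is applied to two points of the ball and never to the centre `v`, which may be
    -- atypical: the law of the estimate may be singular to the prior. The triangle inequality
    -- through `v` gives the factor two.
    refine hz.trans ((discrepancy_triangle PX q z.1 v z.2).trans ((add_le_add hzT.1 hzT.2).trans ?_))
    rw [← ENNReal.ofReal_add hr.le hr.le, two_mul]
  have h2 : edist (z.1 : Fin d → ℝ) (z.2 : Fin d → ℝ) ≤ ENNReal.ofReal (2 * r) / ENNReal.ofReal mu :=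
    (ENNReal.le_div_iff_mul_le (Or.inl (by simpa using hmu)) (Or.inl ENNReal.ofReal_ne_top)).2
      (by rwa [mul_comm])
  rw [← ENNReal.ofReal_div_of_pos hmu] at h2
  rwa [div_mul_eq_mul_div]

theorem lintegral_exp_discrepancy_le (h𝒲 : MeasurableSet 𝒲) (PX : Measure 𝒳)
    [IsProbabilityMeasure PX] (PW : Measure 𝒲) [SFinite PW] (q : Kernel (𝒳 × 𝒲) Bool)
    (hρ : Measurable fun z : 𝒲 × 𝒲 => PX (discrepancySet q z.1 z.2)) {mu : ℝ} (hmu : 0 < mu)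
    (hae : ∀ᵐ z ∂(PW.prod PW), ENNReal.ofReal mu * edist (z.1 : Fin d → ℝ) (z.2 : Fin d → ℝ) ≤
      PX (discrepancySet q z.1 z.2))
    (ν : Measure 𝒲) [SFinite ν] (hν : ν ≤ volume.comap Subtype.val) (hac : ν ≪ PW) (v : 𝒲)
    {s : ℝ} (hs : 0 < s) :
    ∫⁻ w, ENNReal.ofReal (Real.exp (-s * PX.real (discrepancySet q w v))) ∂ν ≤
      ENNReal.ofReal (d.factorial * (2 / mu / s) ^ d) := by
  have hρv : Measurable fun w => PX (discrepancySet q w v) :=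
    hρ.comp (measurable_prodMk_right (y := v))
  refine lintegral_exp_neg_le ν hρv.ennreal_toReal (fun w => measureReal_nonneg) hs (by positivity)
    fun r hr => ?_
  have hset : {w | PX.real (discrepancySet q w v) ≤ r} =
      {w | PX (discrepancySet q w v) ≤ ENNReal.ofReal r} := by
    ext w
    exact (ENNReal.le_ofReal_iff_toReal_le (measure_ne_top _ _) hr.le).symm
  rw [show {w | (PX (discrepancySet q w v)).toReal ≤ r} = _ from hset]
  exact volume_discrepancy_ball_le h𝒲 PX PW q hmu hae ν hν hac v hr
    (measurableSet_le hρv measurable_const)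

end Sensitivity

/-! ### Densities on a subset of `ℝ^d` -/

section Density

variable {d : ℕ} {𝒲 : Set (Fin d → ℝ)}

theorem sigmaFinite_comap_val (h𝒲 : MeasurableSet 𝒲) :
    SigmaFinite ((volume : Measure (Fin d → ℝ)).comap (Subtype.val : 𝒲 → Fin d → ℝ)) := by
  refine SigmaFinite.of_map _ measurable_subtype_coe.aemeasurable ?_
  rw [map_comap_subtype_coe h𝒲]
  infer_instance

theorem eq_withDensity_comap (h𝒲 : MeasurableSet 𝒲) (PW : Measure 𝒲) [IsProbabilityMeasure PW]
    (hPW : PW.map (Subtype.val : 𝒲 → Fin d → ℝ) ≪ volume) :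
    PW = (volume.comap (Subtype.val : 𝒲 → Fin d → ℝ)).withDensity
      fun w => (PW.map (Subtype.val : 𝒲 → Fin d → ℝ)).rnDeriv volume w := by
  have hemb := MeasurableEmbedding.subtype_coe h𝒲
  have : IsProbabilityMeasure (PW.map (Subtype.val : 𝒲 → Fin d → ℝ)) :=
    Measure.isProbabilityMeasure_map measurable_subtype_coe.aemeasurable
  set f := (PW.map (Subtype.val : 𝒲 → Fin d → ℝ)).rnDeriv volume with hf
  ext S hS
  have hS' : MeasurableSet ((Subtype.val : 𝒲 → Fin d → ℝ) '' S) := hemb.measurableSet_image.2 hS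
  have hind : ∀ w : 𝒲, ((Subtype.val : 𝒲 → Fin d → ℝ) '' S).indicator f w =
      S.indicator (fun w => f w) w := fun w => by
    classical
    rw [Set.indicator_apply, Set.indicator_apply]
    exact if_congr Subtype.val_injective.mem_set_image rfl rfl
  calc PW S = PW.map (Subtype.val : 𝒲 → Fin d → ℝ) (Subtype.val '' S) := by
        rw [hemb.map_apply, Set.preimage_image_eq _ Subtype.val_injective]
    _ = ∫⁻ x in Subtype.val '' S, f x := (Measure.setLIntegral_rnDeriv hPW _).symm
    _ = ∫⁻ x in 𝒲, ((Subtype.val : 𝒲 → Fin d → ℝ) '' S).indicator f x := by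
        rw [lintegral_indicator hS', Measure.restrict_restrict hS',
          Set.inter_eq_left.2 (Subtype.coe_image_subset 𝒲 S)]
    _ = ∫⁻ w, S.indicator (fun w => f w) w ∂(volume.comap (Subtype.val : 𝒲 → Fin d → ℝ)) := by
        rw [← lintegral_subtype_comap h𝒲]
        exact lintegral_congr hind
    _ = _ := by rw [lintegral_indicator hS, withDensity_apply _ hS]

/-- The density vanishes almost everywhere off `𝒲`, so with `G 0 = 0` the complement contributes
nothing. This moves the entropy integrals to the subtype. -/
theorem lintegral_comp_rnDeriv (h𝒲 : MeasurableSet 𝒲) (PW : Measure 𝒲) [IsProbabilityMeasure PW]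
    (hPW : PW.map (Subtype.val : 𝒲 → Fin d → ℝ) ≪ volume) {G : ℝ → ℝ≥0∞} (hG0 : G 0 = 0) :
    ∫⁻ x, G ((PW.map (Subtype.val : 𝒲 → Fin d → ℝ)).rnDeriv volume x).toReal =
      ∫⁻ w : 𝒲, G ((PW.map (Subtype.val : 𝒲 → Fin d → ℝ)).rnDeriv volume w).toReal
        ∂(volume.comap Subtype.val) := by
  have : IsProbabilityMeasure (PW.map (Subtype.val : 𝒲 → Fin d → ℝ)) :=
    Measure.isProbabilityMeasure_map measurable_subtype_coe.aemeasurable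
  set f := (PW.map (Subtype.val : 𝒲 → Fin d → ℝ)).rnDeriv volume with hf
  have h0 : ∫⁻ x in 𝒲ᶜ, f x = 0 := by
    rw [Measure.setLIntegral_rnDeriv hPW, Measure.map_apply measurable_subtype_coe h𝒲.compl]
    simp
  have h1 := (lintegral_eq_zero_iff (Measure.measurable_rnDeriv _ _)).1 h0
  have h2 : ∫⁻ x in 𝒲ᶜ, G (f x).toReal = 0 := by
    rw [lintegral_congr_ae (g := fun _ => 0), lintegral_zero]
    filter_upwards [h1] with x hx
    rw [show f x = 0 from hx, ENNReal.toReal_zero, hG0]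
  rw [← lintegral_add_compl _ h𝒲, h2, add_zero]
  exact (lintegral_subtype_comap h𝒲 (fun x => G (f x).toReal)).symm

end Density

/-! ### The entropy inequality for the noisy model -/

section Main

variable {𝒳 : Type*} [MeasurableSpace 𝒳] {d : ℕ} {𝒲 : Set (Fin d → ℝ)}

theorem entropy_le (h𝒲 : MeasurableSet 𝒲) (PX : Measure 𝒳) [IsProbabilityMeasure PX]
    (PW : Measure 𝒲) [IsProbabilityMeasure PW]
    (hPW : PW.map (Subtype.val : 𝒲 → Fin d → ℝ) ≪ volume)
    (p : Kernel (𝒳 × 𝒲) Bool) [IsMarkovKernel p] (hp : IsRealizable p)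
    {D : ℕ} (hD : vcDimension p = D) (noise : Kernel (𝒳 × Bool) Bool) [IsMarkovKernel noise]
    {t : ℝ} (ht : 0 < t) (hmargin : TsybakovMammen (noisyLabels p noise) t)
    {mu : ℝ} (hmu : 0 < mu) (hsens : SensitiveInExpectation PX PW (noisyLabels p noise) mu)
    {n : ℕ} (Q : Kernel (Fin n → 𝒳 × Bool) 𝒲) [IsMarkovKernel Q] {s : ℝ} (hs : 0 < s) :
    differentialEntropy (PW.map (Subtype.val : 𝒲 → Fin d → ℝ)) ≤
      ((Real.log (((∑ k ∈ Finset.Iic D, n.choose k : ℕ) : ℝ) *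
        (d.factorial * (2 / mu / s) ^ d)) +
        s * (∫⁻ w, ∫⁻ v, PX (discrepancySet (noisyLabels p noise) w v)
          ∂(estimateLaw PX (noisyLabels p noise) Q w) ∂PW).toReal : ℝ) : EReal) := by
  set q := noisyLabels p noise with hq
  set κ := estimateLaw PX q Q with hκ
  set vol : Measure 𝒲 := volume.comap Subtype.val with hvol
  have hsf : SigmaFinite vol := sigmaFinite_comap_val h𝒲
  set f := (PW.map (Subtype.val : 𝒲 → Fin d → ℝ)).rnDeriv volume with hf
  have hfm : Measurable fun w : 𝒲 => f w :=
    (Measure.measurable_rnDeriv _ _).comp measurable_subtype_coe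
  set φ : 𝒲 → ℝ := fun w => (f w).toReal with hφ
  have hφm : Measurable φ := hfm.ennreal_toReal
  have hφ0 : ∀ w, 0 ≤ φ w := fun w => ENNReal.toReal_nonneg
  have hdens : PW = vol.withDensity fun w => f w := eq_withDensity_comap h𝒲 PW hPW
  have hlint : ∀ g : 𝒲 → ℝ≥0∞, Measurable g → ∫⁻ w, g w ∂PW = ∫⁻ w, f w * g w ∂vol :=
    fun g hg => by
      rw [hdens]
      exact lintegral_withDensity_eq_lintegral_mul _ hfm hg
  have hf1 : ∫⁻ w, f w ∂vol = 1 := by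
    have := hlint (fun _ => 1) measurable_const
    simpa using this.symm
  have hffin : ∀ᵐ w : 𝒲 ∂vol, f w < ∞ := ae_lt_top hfm (by rw [hf1]; exact ENNReal.one_ne_top)
  have hφint : Integrable φ vol :=
    integrable_toReal_of_lintegral_ne_top hfm.aemeasurable (by rw [hf1]; exact ENNReal.one_ne_top)
  have hφ1 : ∫ w, φ w ∂vol = 1 := by
    rw [integral_toReal hfm.aemeasurable hffin, hf1, ENNReal.toReal_one]
  have hρ := measurable_discrepancy PX q ht hmargin
  have hae := ae_sensitive PX PW hPW q ht hmargin hsens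
  -- Restricted to where the density is nonzero, Lebesgue measure is absolutely continuous with
  -- respect to the prior, so the almost-sure sensitivity transfers to it.
  set ν := vol.restrict {w | φ w ≠ 0} with hν
  have hSm : MeasurableSet {w | φ w ≠ 0} := hφm (measurableSet_singleton 0).compl
  have hac : ν ≪ PW := by
    refine Measure.AbsolutelyContinuous.mk fun S hS h0 => ?_
    rw [hdens, withDensity_apply_eq_zero hfm] at h0
    rw [hν, Measure.restrict_apply hS]
    refine measure_mono_null ?_ h0
    rintro w ⟨hw, hw'⟩
    refine ⟨fun h => hw' ?_, hw⟩
    simp only [hφ]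
    rw [show f w = 0 from h, ENNReal.toReal_zero]
  set M : ℕ := ∑ k ∈ Finset.Iic D, n.choose k with hM
  have hM0 : 0 < M := by
    refine Finset.sum_pos' (fun _ _ => Nat.zero_le _) ⟨0, by simp, by simp⟩
  have hJ := lintegral_estimateLaw_le p hp hD noise PX Q ν
    (g := fun z => ENNReal.ofReal (Real.exp (-s * PX.real (discrepancySet q z.1 z.2))))
    (hρ.ennreal_toReal.const_mul (-s)).exp.ennreal_ofReal
    (lintegral_exp_discrepancy_le h𝒲 PX PW q hρ hmu hae ν Measure.restrict_le_self hac · hs)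
  have hc : (0 : ℝ) < M * (d.factorial * (2 / mu / s) ^ d) := by positivity
  have hmain := entropy_le_log_add vol φ hφm hφ0 hφint hφ1 κ
    (fun z => PX.real (discrepancySet q z.1 z.2)) hρ.ennreal_toReal (fun _ => measureReal_nonneg)
    (fun _ => measureReal_le_one) hs hc (hJ.trans (by
      rw [ENNReal.ofReal_mul (p := (M : ℝ)) (by positivity), ENNReal.ofReal_natCast]))
  have hh : differentialEntropy (PW.map (Subtype.val : 𝒲 → Fin d → ℝ)) =
      ((∫⁻ w, ENNReal.ofReal (Real.negMulLog (φ w)) ∂vol : ℝ≥0∞) : EReal) -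
      ((∫⁻ w, ENNReal.ofReal (-Real.negMulLog (φ w)) ∂vol : ℝ≥0∞) : EReal) := by
    rw [differentialEntropy,
      lintegral_comp_rnDeriv h𝒲 PW hPW (G := fun y => ENNReal.ofReal (Real.negMulLog y)) (by simp),
      lintegral_comp_rnDeriv h𝒲 PW hPW (G := fun y => ENNReal.ofReal (-Real.negMulLog y)) (by simp)]
  have hint : ∫ w, φ w * ∫ v, PX.real (discrepancySet q w v) ∂(κ w) ∂vol =
      (∫⁻ w, ∫⁻ v, PX (discrepancySet q w v) ∂(κ w) ∂PW).toReal := by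
    have hinner : ∀ w, ∫ v, PX.real (discrepancySet q w v) ∂(κ w) =
        (∫⁻ v, PX (discrepancySet q w v) ∂(κ w)).toReal := fun w =>
      integral_toReal (hρ.comp measurable_prodMk_left).aemeasurable
        (Filter.Eventually.of_forall fun v => measure_lt_top _ _)
    have hκm : Measurable fun w => ∫⁻ v, PX (discrepancySet q w v) ∂(κ w) :=
      hρ.lintegral_kernel_prod_right'
    have hκfin : ∀ w, ∫⁻ v, PX (discrepancySet q w v) ∂(κ w) < ∞ := fun w =>
      ((lintegral_mono fun v => prob_le_one).trans (by simp)).trans_lt ENNReal.one_lt_top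
    simp_rw [hinner]
    rw [hlint _ hκm, ← integral_toReal
      (f := fun w : 𝒲 => f w * ∫⁻ v, PX (discrepancySet q w v) ∂(κ w)) (hfm.mul hκm).aemeasurable]
    · simp only [ENNReal.toReal_mul, hφ]
    · filter_upwards [hffin] with w hw using ENNReal.mul_lt_top hw (hκfin w)
  rw [hh, ← hint]
  exact hmain

end Main

end LabelNoise

end

/-! ### The lower bound on the excess Bayes risk -/

theorem mainTheorem6
    {𝒳 : Type*} [MeasurableSpace 𝒳] {dw : ℕ} (hdw : 0 < dw)
    {𝒲 : Set (Fin dw → ℝ)} (h𝒲 : MeasurableSet 𝒲)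
    (PX : Measure 𝒳) [IsProbabilityMeasure PX]
    (PW : Measure 𝒲) [IsProbabilityMeasure PW]
    (hPW : PW.map (Subtype.val : 𝒲 → Fin dw → ℝ) ≪ volume)
    (p : Kernel (𝒳 × 𝒲) Bool) [IsMarkovKernel p] (hp : LabelNoise.IsRealizable p)
    (dvc : ℕ) (hdvc : LabelNoise.vcDimension p = dvc)
    (noise : Kernel (𝒳 × Bool) Bool) [IsMarkovKernel noise]
    (t : ℝ) (ht : 0 < t) (hmargin : LabelNoise.TsybakovMammen (LabelNoise.noisyLabels p noise) t)
    (mu : ℝ) (hmu : 0 < mu)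
    (hsens : LabelNoise.SensitiveInExpectation PX PW (LabelNoise.noisyLabels p noise) mu)
    (n : ℕ) (hn : dvc ≤ n)
    (Q : Kernel (Fin n → 𝒳 × Bool) 𝒲) [IsMarkovKernel Q] :
    ((mu * t / (2 * Real.exp 1) *
        ((dvc : ℝ) / (Real.exp 1 * n)) ^ ((dvc : ℝ) / (dw : ℝ)) : ℝ) : EReal) *
      ((EReal.exp (LabelNoise.differentialEntropy (PW.map (Subtype.val : 𝒲 → Fin dw → ℝ)) /
        ((dw : ℝ) : EReal)) : ENNReal) : EReal)
      ≤ ((LabelNoise.excessBayesRisk PX PW (LabelNoise.noisyLabels p noise) Q : ℝ) : EReal) := by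
  set X : EReal := ((EReal.exp (LabelNoise.differentialEntropy
    (PW.map (Subtype.val : 𝒲 → Fin dw → ℝ)) / ((dw : ℝ) : EReal)) : ENNReal) : EReal) with hX
  have hX0 : 0 ≤ X := EReal.coe_ennreal_nonneg _
  set M : ℕ := ∑ k ∈ Finset.Iic dvc, n.choose k with hM
  have hM0 : 0 < M := Finset.sum_pos' (fun _ _ => Nat.zero_le _) ⟨0, by simp, by simp⟩
  have hM0' : (0 : ℝ) < M := by exact_mod_cast hM0
  have hMle : (M : ℝ) ≤ (Real.exp 1 * n / dvc) ^ dvc := by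
    rw [hM]; push_cast; exact LabelNoise.sum_choose_le_exp_pow hn
  -- The negative exponent `-1/dw` reverses the bound on the number of patterns. The case `dvc = 0`
  -- is included, both powers then being one.
  have hpow : ((dvc : ℝ) / (Real.exp 1 * n)) ^ ((dvc : ℝ) / (dw : ℝ)) ≤
      (M : ℝ) ^ (-(1 / (dw : ℝ))) := by
    have h0 : (0 : ℝ) ≤ Real.exp 1 * n / dvc := by positivity
    calc ((dvc : ℝ) / (Real.exp 1 * n)) ^ ((dvc : ℝ) / (dw : ℝ))
        = ((Real.exp 1 * n / dvc) ^ dvc) ^ (-(1 / (dw : ℝ))) := by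
          rw [← Real.rpow_natCast, ← Real.rpow_mul h0, mul_neg, mul_one_div, Real.rpow_neg h0,
            ← Real.inv_rpow h0, inv_div]
      _ ≤ (M : ℝ) ^ (-(1 / (dw : ℝ))) :=
          Real.rpow_le_rpow_of_nonpos hM0' hMle (by simp)
  have hbound := LabelNoise.entropy_power_le hdw hM0' hmu ENNReal.toReal_nonneg fun s hs =>
    LabelNoise.entropy_le h𝒲 PX PW hPW p hp hdvc noise ht hmargin hmu hsens Q hs
  have hrisk := LabelNoise.discrepancy_le_excessBayesRisk PX (LabelNoise.noisyLabels p noise) ht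
    hmargin PW Q
  rw [← hX] at hbound
  set D := (∫⁻ w, ∫⁻ v, PX (LabelNoise.discrepancySet (LabelNoise.noisyLabels p noise) w v)
    ∂(LabelNoise.estimateLaw PX (LabelNoise.noisyLabels p noise) Q w) ∂PW).toReal with hDdef
  calc _ ≤ ((t * (mu / (2 * Real.exp 1) * (M : ℝ) ^ (-(1 / (dw : ℝ)))) : ℝ) : EReal) * X := by
        refine mul_le_mul_of_nonneg_right (EReal.coe_le_coe_iff.2 ?_) hX0
        calc _ = t * (mu / (2 * Real.exp 1) *
              ((dvc : ℝ) / (Real.exp 1 * n)) ^ ((dvc : ℝ) / (dw : ℝ))) := by ring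
          _ ≤ _ := by gcongr
    _ = (t : EReal) *
        (((mu / (2 * Real.exp 1) * (M : ℝ) ^ (-(1 / (dw : ℝ))) : ℝ) : EReal) * X) := by
        rw [EReal.coe_mul, mul_assoc]
    _ ≤ (t : EReal) * (D : EReal) :=
        mul_le_mul_of_nonneg_left hbound (by exact_mod_cast ht.le)
    _ ≤ _ := by
        rw [← EReal.coe_mul]
        exact EReal.coe_le_coe_iff.2 hrisk
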